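/- **Notation.** For points $x,y\in\mathbb R^d$ let $c(x,y)=\|x-y\|_2^2$, and for a nonempty finite set $S$ of points let $c(x,S)=\min_{s\in S}c(x,s)$. Clients and facilities are finite families of points of $\mathbb R^d$. **Algorithm.** Given a finite set $\mathcal V$ of facilities with numbers $t_i\ge 0$ ($i\in\mathcal V$), let $H(\delta)$ be the graph on $\mathcal V$ in which distinct $i,i'$ are adjacent iff $c(i,i')\le\delta\min(t_i,t_{i'})$. With parameters $\delta_1,\delta_2,\delta_3,p$: 1. choose a maximal independent set $I_1$ of $H(\delta_1)$; 2. let $V_2$ be the set of points of $\mathcal V\setminus I_1$ not adjacent to $I_1$ in $H(\delta_2)$, and choose a maximal independent set $I_2$ of $H(\delta_2)[V_2]$; 3. let $V_3$ be the set of points of $V_2\setminus I_2$ that have exactly one neighbour in $I_2$ in $H(\delta_2)$, no neighbour in $I_1$ in $H(\delta_2)$ and no neighbour in $I_2$ in $H(\delta_3)$, and choose a maximal independent set $I_3$ of $H(\delta_2)[V_3]$; for $i\in I_3$ let $q(i)\in I_2$ be its unique neighbour in $I_2$ in $H(\delta_2)$; 4. the random set $S$ contains all of $I_1$, and for every $i\in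 I_2$ an independent fair coin is flipped: on heads, $i$ is put into $S$ with probability $2p$; on tails, every point of $q^{-1}(i)$ is independently put into $S$ with probability $2p$. **Assumptions (A).** $\mathcal D$ is a set of clients, $\alpha_j\ge0$ for $j\in\mathcal D$, $t_i\ge 0$ for $i\in\mathcal V$, and every client $j$ has a set $N(j)\subseteq\mathcal V$ and a witness $w(j)\in\mathcal V$ such that $\alpha_j\ge t_{w(j)}$, $\alpha_j\ge c(j,w(j))$, and $t_i\ge\alpha_j>c(j,i)$ for all $i\in N(j)$. **LMP algorithm.** Given nonempty finite families $\mathcal F$ of facilities and $\mathcal D$ of clients and $\lambda\ge0$, let all $\alpha_j$ grow from $0$ at unit speed, and stop $\alpha_j$ at the first time at which some facility $i$ with $c(j,i)\le\alpha_j$ is tight, i.e. satisfies $\sum_{j'}\max(\alpha_{j'}-c(j',i),0)=\lambda$ for the current values. For the final $\alpha$ let $\mathcal V$ be the set of tight facilities, $t_i=\max\{\alpha_j:\alpha_j>c(j,i)\}$ (and $0$ if there is no such $j$), and apply the algorithm above to $\mathcal V$. Let $\mathrm{OPT}(\lambda)$ be the minimum of $\sum_{i,j}x_{ij}c(j,i)+\lambda\sum_i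 y_i$ subject to $\sum_i x_{ij}\ge1$ for all $j$ and $0\le x_{ij}\le y_i$ for all $i,j$. The algorithm is an LMP $\rho$-approximation in expectation if for all $d,\mathcal F,\mathcal D,\lambda$ it can be carried out and, whatever independent sets are chosen, $$\mathbb E\Big[\sum_{j\in\mathcal D}c(j,S)\Big]\le\rho\cdot\big(\mathrm{OPT}(\lambda)-\lambda\,\mathbb E|S|\big).$$ **Theorem.** Let $\delta_1=\frac{4+8\sqrt2}{7}$, $\delta_2=2$, and let $\delta_3$ be either $6-4\sqrt2$ or $0.265$. There is a function $\rho$ of $p$ alone such that the following hold. (a) For every $0\le p<\frac12$, in every dimension, under the assumptions (A), and for every choice of $I_1,I_2,I_3$, every client $j$ satisfies $$\mathbb E[c(j,S)]\le\rho(p)\cdot\mathbb E\Big[\alpha_j-\sum_{i\in N(j)\cap S}(\alpha_j-c(j,i))\Big].$$ (b) For every $0\le p<\frac12$ the LMP algorithm is an LMP $\rho(p)$-approximation in expectation for Euclidean $k$-means. (c) For every $p\in[0.096,0.402]$, $\rho(p)$ is at most the maximum of the four numbers $$3+2\sqrt2,\qquad 1+2p+(1-p)\delta_1+2\sqrt{2p^2+(1-p)\delta_1},\qquad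 \frac{(1-p)(1+\sqrt{\delta_1})^2+p(1-\sqrt{\delta_3})^2}{1-p+p(1-\sqrt{\delta_3})^2},$$ $$\frac{(1-2p)(1+\sqrt{\delta_1})^2\big(\delta_1+(\sqrt{\delta_1}+\sqrt{\delta_3})^2\big)+p(1+\sqrt{\delta_1})^2\delta_3}{(1-2p)\big(\delta_1+(\sqrt{\delta_1}+\sqrt{\delta_3})^2\big)+p(1+\sqrt{\delta_1})^2\delta_3}.$$ (d) $\rho(0.402)\le3+2\sqrt2$; in particular, for $p=0.402$ the LMP algorithm is an LMP $(3+2\sqrt2)$-approximation in expectation for Euclidean $k$-means. -/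

import Mathlib

universe u v

noncomputable section

namespace KMeansLMP

/-- The squared-distance (`k`-means) cost between two points of Euclidean space. -/
def cost {d : ℕ} (x y : EuclideanSpace ℝ (Fin d)) : ℝ := dist x y ^ 2

/-- `c(x, S)`: the least cost from `x` to a facility of the (nonempty) finite set `S`. Facilities are
indexed by `F` and `fac` gives their positions. -/
def costTo {d : ℕ} {F : Type*} (fac : F → EuclideanSpace ℝ (Fin d))
    (x : EuclideanSpace ℝ (Fin d)) (S : Finset F) : ℝ :=
  ⨅ i : S, cost x (fac i)

/-! ### Conflict graphs and nested quasi-independent sets -/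

/-- The conflict graph `H(δ)`: `i ≠ i'` are adjacent iff `c(i, i') ≤ δ · min(t_i, t_{i'})`. -/
def conflictGraph {d : ℕ} {F : Type*} (fac : F → EuclideanSpace ℝ (Fin d)) (t : F → ℝ) (δ : ℝ) :
    SimpleGraph F where
  Adj i i' := i ≠ i' ∧ cost (fac i) (fac i') ≤ δ * min (t i) (t i')
  symm := ⟨fun i i' h => ⟨h.1.symm, by
    have h2 := h.2
    unfold cost at h2 ⊢
    rwa [dist_comm, min_comm]⟩⟩
  loopless := ⟨fun _ h => h.1 rfl⟩

/-- `I` is a maximal independent set of the induced subgraph `G[V]`. -/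
def IsMaxIndepIn {F : Type*} (G : SimpleGraph F) (V I : Finset F) : Prop :=
  Maximal (fun J : Finset F => J ⊆ V ∧ G.IsIndepSet (J : Set F)) I

open scoped Classical in
/-- The points of `V₁ \ I₁` that are not adjacent to `I₁` in `H(δ₂)`. -/
def levelTwo {d : ℕ} {F : Type*} [DecidableEq F] (fac : F → EuclideanSpace ℝ (Fin d)) (t : F → ℝ)
    (δ₂ : ℝ) (V₁ I₁ : Finset F) : Finset F :=
  {i ∈ V₁ \ I₁ | ∀ i' ∈ I₁, ¬ (conflictGraph fac t δ₂).Adj i i'}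

open scoped Classical in
/-- The points of `V₂ \ I₂` having exactly one neighbour in `I₂` in `H(δ₂)`, no neighbour in `I₁` in
`H(δ₂)`, and no neighbour in `I₂` in `H(δ₃)`. -/
def levelThree {d : ℕ} {F : Type*} [DecidableEq F] (fac : F → EuclideanSpace ℝ (Fin d)) (t : F → ℝ)
    (δ₂ δ₃ : ℝ) (V₁ I₁ I₂ : Finset F) : Finset F :=
  {i ∈ levelTwo fac t δ₂ V₁ I₁ \ I₂ |
    (∃! i', i' ∈ I₂ ∧ (conflictGraph fac t δ₂).Adj i i') ∧
    (∀ i' ∈ I₁, ¬ (conflictGraph fac t δ₂).Adj i i') ∧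
    (∀ i' ∈ I₂, ¬ (conflictGraph fac t δ₃).Adj i i')}

/-- `(I₁, I₂, I₃)` is a nested quasi-independent set that the algorithm may produce from `V₁`. -/
structure IsNestedQuasiIndep {d : ℕ} {F : Type*} [DecidableEq F]
    (fac : F → EuclideanSpace ℝ (Fin d)) (t : F → ℝ) (δ₁ δ₂ δ₃ : ℝ) (V₁ I₁ I₂ I₃ : Finset F) :
    Prop where
  first : IsMaxIndepIn (conflictGraph fac t δ₁) V₁ I₁
  second : IsMaxIndepIn (conflictGraph fac t δ₂) (levelTwo fac t δ₂ V₁ I₁) I₂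
  third : IsMaxIndepIn (conflictGraph fac t δ₂) (levelThree fac t δ₂ δ₃ V₁ I₁ I₂) I₃

/-! ### The random set of centers -/

/-- The outcomes of all coins: `ω.1 i` is the fair coin of `i` (`true` is heads), and `ω.2 i` is the
coin of bias `2p` that decides about including `i`. -/
abbrev Coins (F : Type*) : Type _ := (F → Bool) × (F → Bool)

/-- The probability of an outcome, all coins being independent. -/
def coinProb {F : Type*} [Fintype F] (p : ℝ) (ω : Coins F) : ℝ :=
  (∏ _i : F, (1 / 2 : ℝ)) * ∏ i : F, if ω.2 i then 2 * p else 1 - 2 * p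

/-- The expectation of a random variable on the coin flips. -/
def expect {F : Type*} [Fintype F] [DecidableEq F] (p : ℝ) (f : Coins F → ℝ) : ℝ :=
  ∑ ω : Coins F, coinProb p ω * f ω

open scoped Classical in
/-- The set `S`: all of `I₁`; every `i ∈ I₂` whose fair coin is heads and whose biased coin succeeds;
every `i ∈ I₃` whose biased coin succeeds and for whose (unique) `H(δ₂)`-neighbour `q(i) ∈ I₂` the
fair coin is tails. -/
def centers {d : ℕ} {F : Type*} [DecidableEq F] (fac : F → EuclideanSpace ℝ (Fin d)) (t : F → ℝ)
    (δ₂ : ℝ) (I₁ I₂ I₃ : Finset F) (ω : Coins F) : Finset F :=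
  I₁ ∪ {i ∈ I₂ | ω.1 i = true ∧ ω.2 i = true} ∪
    {i ∈ I₃ | ω.2 i = true ∧
      ∃ q ∈ I₂, (conflictGraph fac t δ₂).Adj i q ∧ ω.1 q = false}

/-! ### The abstract setting of witnesses and neighbourhoods -/

/-- The standing assumptions on the dual values `α`, the facility values `t`, the neighbourhoods `N`
and the witnesses `w`, relative to a finite set `V` of facilities; `cl` gives client positions. -/
structure WitnessAssumptions {d : ℕ} {F D : Type*} (fac : F → EuclideanSpace ℝ (Fin d))
    (cl : D → EuclideanSpace ℝ (Fin d)) (V : Finset F) (α : D → ℝ) (t : F → ℝ)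
    (N : D → Finset F) (w : D → F) : Prop where
  alpha_nonneg : ∀ j, 0 ≤ α j
  t_nonneg : ∀ i ∈ V, 0 ≤ t i
  nbhd_subset : ∀ j, N j ⊆ V
  witness_mem : ∀ j, w j ∈ V
  t_witness_le : ∀ j, t (w j) ≤ α j
  cost_witness_le : ∀ j, cost (cl j) (fac (w j)) ≤ α j
  alpha_le_t : ∀ j, ∀ i ∈ N j, α j ≤ t i
  cost_lt_alpha : ∀ j, ∀ i ∈ N j, cost (cl j) (fac i) < α j

/-! ### The Lagrangian relaxation and the primal-dual procedure -/

/-- `(x, y)` is feasible for the linear program `LP'(lam)`. -/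
structure LPFeasible {F D : Type*} [Fintype F] (x : F → D → ℝ) (y : F → ℝ) : Prop where
  covered : ∀ j, 1 ≤ ∑ i, x i j
  nonneg : ∀ i j, 0 ≤ x i j
  le_open : ∀ i j, x i j ≤ y i

/-- The objective of `LP'(lam)`: connection cost plus `lam` times the amount of opened facilities. -/
def lpValue {d : ℕ} {F D : Type*} [Fintype F] [Fintype D] (fac : F → EuclideanSpace ℝ (Fin d))
    (cl : D → EuclideanSpace ℝ (Fin d)) (lam : ℝ) (x : F → D → ℝ) (y : F → ℝ) : ℝ :=
  (∑ i, ∑ j, x i j * cost (cl j) (fac i)) + lam * ∑ i, y i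

/-- `OPT(lam)`, the optimum of `LP'(lam)`. With at least one facility, at least one client and
`lam ≥ 0`, the set of values is nonempty and bounded below by `0`. -/
def lpOpt {d : ℕ} {F D : Type*} [Fintype F] [Fintype D] (fac : F → EuclideanSpace ℝ (Fin d))
    (cl : D → EuclideanSpace ℝ (Fin d)) (lam : ℝ) : ℝ :=
  sInf {v | ∃ (x : F → D → ℝ) (y : F → ℝ), LPFeasible x y ∧ v = lpValue fac cl lam x y}

/-- `∑_j max(α_j - c(j, i), 0)`, the left side of the dual constraint of the facility `i`. -/
def payment {d : ℕ} {F D : Type*} [Fintype D] (fac : F → EuclideanSpace ℝ (Fin d))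
    (cl : D → EuclideanSpace ℝ (Fin d)) (α : D → ℝ) (i : F) : ℝ :=
  ∑ j, max (α j - cost (cl j) (fac i)) 0

/-- `α` is the vector at which the primal-dual procedure ends. All clients grow at unit speed from
`0`, and client `j` freezes at time `α j`, so that its value at time `θ` is `min (α j) θ`. It freezes
at the first time `θ` at which there is a facility `i` with `c(j, i) ≤ θ` whose dual constraint is
tight for the values at time `θ`: either `i` becomes tight at that moment, or `i` has already been
tight and the value of `j` reaches `c(j, i)`. Such an `i` is a witness of `j`. -/
def IsPrimalDualOutput {d : ℕ} {F D : Type*} [Fintype D] (fac : F → EuclideanSpace ℝ (Fin d))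
    (cl : D → EuclideanSpace ℝ (Fin d)) (lam : ℝ) (α : D → ℝ) : Prop :=
  ∀ j, IsLeast {θ : ℝ | ∃ i, cost (cl j) (fac i) ≤ θ ∧
    payment fac cl (fun j' => min (α j') θ) i = lam} (α j)

open scoped Classical in
/-- The set of tight facilities. -/
def tightSet {d : ℕ} {F D : Type*} [Fintype F] [Fintype D] (fac : F → EuclideanSpace ℝ (Fin d))
    (cl : D → EuclideanSpace ℝ (Fin d)) (lam : ℝ) (α : D → ℝ) : Finset F :=
  {i | payment fac cl α i = lam}

/-- `t_i`, the maximum of `α_j` over the clients `j` with `α_j > c(j, i)`, and `0` if there is none. -/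
def tValue {d : ℕ} {F D : Type*} (fac : F → EuclideanSpace ℝ (Fin d))
    (cl : D → EuclideanSpace ℝ (Fin d)) (α : D → ℝ) (i : F) : ℝ :=
  ⨆ j : {j : D // cost (cl j) (fac i) < α j}, α j

/-- A possible course of the whole algorithm up to the coin flips: the primal-dual procedure ends at
`α`, and `(I₁, I₂, I₃)` is a nested quasi-independent set of the tight facilities. -/
structure IsRun {d : ℕ} {F D : Type*} [Fintype F] [DecidableEq F] [Fintype D]
    (fac : F → EuclideanSpace ℝ (Fin d)) (cl : D → EuclideanSpace ℝ (Fin d)) (lam δ₁ δ₂ δ₃ : ℝ)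
    (α : D → ℝ) (I₁ I₂ I₃ : Finset F) : Prop where
  dual : IsPrimalDualOutput fac cl lam α
  nested : IsNestedQuasiIndep fac (tValue fac cl α) δ₁ δ₂ δ₃ (tightSet fac cl lam α) I₁ I₂ I₃

/-- The algorithm with parameters `δ₁, δ₂, δ₃, p` is a Lagrangian multiplier preserving
`ρ`-approximation in expectation for Euclidean `k`-means: for all finite nonempty families of
facilities and of clients and all `lam ≥ 0` it can be run, and in every run
`E[∑_j c(j, S)] ≤ ρ · (OPT(lam) - lam · E|S|)`. -/
def IsLMPApprox (δ₁ δ₂ δ₃ p ρ : ℝ) : Prop :=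
  ∀ (d : ℕ) (F : Type u) (D : Type v) [Fintype F] [DecidableEq F] [Fintype D] [Nonempty F]
    [Nonempty D] (fac : F → EuclideanSpace ℝ (Fin d)) (cl : D → EuclideanSpace ℝ (Fin d)) (lam : ℝ),
    0 ≤ lam →
    (∃ (α : D → ℝ) (I₁ I₂ I₃ : Finset F), IsRun fac cl lam δ₁ δ₂ δ₃ α I₁ I₂ I₃) ∧
    ∀ (α : D → ℝ) (I₁ I₂ I₃ : Finset F), IsRun fac cl lam δ₁ δ₂ δ₃ α I₁ I₂ I₃ →
      expect p (fun ω => ∑ j, costTo fac (cl j)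
          (centers fac (tValue fac cl α) δ₂ I₁ I₂ I₃ ω)) ≤
        ρ * (lpOpt fac cl lam -
          lam * expect p (fun ω =>
            ((centers fac (tValue fac cl α) δ₂ I₁ I₂ I₃ ω).card : ℝ)))

/-- The guarantee for single clients in the abstract setting:
`E[c(j, S)] ≤ ρ · E[α_j - ∑_{i ∈ N(j) ∩ S} (α_j - c(j, i))]` for every client `j`. -/
def HasClientGuarantee (δ₁ δ₂ δ₃ p ρ : ℝ) : Prop :=
  ∀ (d : ℕ) (F : Type u) (D : Type v) [Fintype F] [DecidableEq F]
    (fac : F → EuclideanSpace ℝ (Fin d)) (cl : D → EuclideanSpace ℝ (Fin d))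
    (V : Finset F) (α : D → ℝ) (t : F → ℝ) (N : D → Finset F) (w : D → F),
    WitnessAssumptions fac cl V α t N w →
    ∀ I₁ I₂ I₃ : Finset F, IsNestedQuasiIndep fac t δ₁ δ₂ δ₃ V I₁ I₂ I₃ →
    ∀ j : D,
      expect p (fun ω => costTo fac (cl j) (centers fac t δ₂ I₁ I₂ I₃ ω)) ≤
        ρ * expect p (fun ω =>
          α j - ∑ i ∈ N j ∩ centers fac t δ₂ I₁ I₂ I₃ ω, (α j - cost (cl j) (fac i)))

end KMeansLMP

end

/-! Condition on the fair coins. The points that can still be opened ("active"), together with `I₁`,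
are then independent in `H(2)`: a point of `I₂` and a point of `I₃` in conflict are governed by the
same coin with opposite outcomes. Since `t_i ≥ α_j` on `N(j)`, these points of `N(j)` have pairwise
cost at least `2α_j`, so by the variance identity for squared distances (`weighted_sum_cost_ge`)
they cannot all be close to `j`.

If `N(j)` meets `I₁`, the guarantee already holds for every fixed outcome of the fair coins
(`biasedExpect_costTo_le_of_inter_nonempty`); the value of `δ₁` is the solution of `(δ₁/2 - 1)(2ρ -
1) = 1` for `ρ = 3 + 2√2`.

Otherwise divide by `α_j` and let `D = c(j, I₁)/α_j`. The route through the witness gives only `D ≤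
(1 + √δ₁)²`, slightly more than `3 + 2√2`. The slack (`ρ` times the net payment, minus the
connection cost) can therefore be negative, but only when at most one point of `N(j)` is active;
such outcomes are balanced against those obtained by flipping one or two fair coins. `SlackBounds`
isolates what this averaging needs, and `sum_slack_nonneg` finds the compensation: - if the witness
is within `2 · min t` of `I₁`, then `D ≤ (1 + √2)²`; - otherwise maximality of `I₂` puts a candidate
near the witness and far from `I₁`, and a convex combination of the two costs is small
(`mix_cost_le`): the second number of (c); - if `N(j)` contains some `e ∈ I₂` and a third-level
point of `e`, one of them is active in every outcome: the fourth number; - if `N(j) = {e}` and no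
other candidate is near the witness, maximality of `I₃` forces `e` within `δ₃` of the witness: the
third number; - if two points of `N(j)` depend on different coins, the outcomes with both active
leave enough room (`pairSlack_bounds`).

For `p` outside `[0.096, 0.402]` the crude value `(1 + √δ₁)²/(1 - 2p)` suffices. The LMP statement
follows by summing over clients, because the final `α` is dual feasible and each tight facility
collects exactly `λ`. -/

noncomputable section

namespace KMeansLMP

/-! ### Expectations over coin flips -/

section Expectation

variable {F : Type*} [Fintype F] [DecidableEq F]

/-- The expectation over independent coins of bias `q`, one for each element of `F`. -/
def biasedExpect (q : ℝ) (g : (F → Bool) → ℝ) : ℝ :=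
  ∑ σ : F → Bool, (∏ i : F, if σ i then q else 1 - q) * g σ

theorem expect_eq_sum_biasedExpect (p : ℝ) (f : Coins F → ℝ) :
    expect p f = (∏ _i : F, (1 / 2 : ℝ)) *
      ∑ ω : F → Bool, biasedExpect (2 * p) (fun σ => f (ω, σ)) := by
  unfold expect coinProb biasedExpect
  rw [Fintype.sum_prod_type, Finset.mul_sum]
  refine Finset.sum_congr rfl fun ω _ => ?_
  rw [Finset.mul_sum]
  refine Finset.sum_congr rfl fun σ _ => ?_
  ring

theorem expect_sum {ι : Type*} (s : Finset ι) (p : ℝ) (f : ι → Coins F → ℝ) :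
    expect p (fun ω => ∑ j ∈ s, f j ω) = ∑ j ∈ s, expect p (f j) := by
  unfold expect
  rw [Finset.sum_comm]
  simp only [Finset.mul_sum]

theorem biasedExpect_mono {q : ℝ} (h0 : 0 ≤ q) (h1 : q ≤ 1) {g h : (F → Bool) → ℝ}
    (hgh : ∀ σ, g σ ≤ h σ) : biasedExpect q g ≤ biasedExpect q h := by
  unfold biasedExpect
  refine Finset.sum_le_sum fun σ _ => mul_le_mul_of_nonneg_left (hgh σ) ?_
  refine Finset.prod_nonneg fun i _ => ?_
  split_ifs <;> linarith

theorem biasedExpect_add (q : ℝ) (g h : (F → Bool) → ℝ) :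
    biasedExpect q (fun σ => g σ + h σ) = biasedExpect q g + biasedExpect q h := by
  simp only [biasedExpect, mul_add, Finset.sum_add_distrib]

theorem biasedExpect_const_mul (q c : ℝ) (g : (F → Bool) → ℝ) :
    biasedExpect q (fun σ => c * g σ) = c * biasedExpect q g := by
  simp only [biasedExpect, Finset.mul_sum]
  exact Finset.sum_congr rfl fun _ _ => by ring

theorem biasedExpect_sum {ι : Type*} (s : Finset ι) (q : ℝ) (g : ι → (F → Bool) → ℝ) :
    biasedExpect q (fun σ => ∑ i ∈ s, g i σ) = ∑ i ∈ s, biasedExpect q (g i) := by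
  unfold biasedExpect
  rw [Finset.sum_comm]
  simp only [Finset.mul_sum]

/-- The indicator of success of the coin of `i`. -/
def success (i : F) (σ : F → Bool) : ℝ := if σ i then 1 else 0

/-- Independence: weight times indicator is a product of functions of single coins, so the sum over
`σ` factors into two-term sums, each equal to `q` on `T` and to `1` off `T`. -/
theorem biasedExpect_prod_success (q : ℝ) (T : Finset F) :
    biasedExpect q (fun σ => ∏ i ∈ T, success i σ) = q ^ T.card := by
  have h1 : ∀ σ : F → Bool, (∏ i : F, if σ i then q else 1 - q) * ∏ i ∈ T, success i σ
      = ∏ i : F, (fun (i : F) (b : Bool) =>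
          (if b then q else 1 - q) * (if i ∈ T then (if b then 1 else 0) else 1)) i (σ i) := by
    intro σ
    rw [Finset.prod_mul_distrib]
    congr 1
    rw [Finset.prod_ite_mem, Finset.univ_inter]
    rfl
  unfold biasedExpect
  have h3 := Finset.prod_univ_sum (fun _ : F => (Finset.univ : Finset Bool)) (fun i b =>
    (if b then q else 1 - q) * (if i ∈ T then (if b then (1 : ℝ) else 0) else 1))
  rw [Fintype.piFinset_univ] at h3
  rw [Finset.sum_congr rfl fun σ _ => h1 σ, ← h3]
  have h2 : ∀ i : F, (∑ b : Bool, (if b then q else 1 - q) *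
      (if i ∈ T then (if b then (1 : ℝ) else 0) else 1)) = if i ∈ T then q else 1 := by
    intro i
    by_cases hi : i ∈ T <;> simp [hi]
  simp only [h2]
  rw [Finset.prod_ite_mem, Finset.univ_inter, Finset.prod_const]

theorem biasedExpect_const (q c : ℝ) : biasedExpect q (fun _ : F → Bool => c) = c := by
  have h := biasedExpect_const_mul q c (fun _ : F → Bool => 1)
  have h1 := biasedExpect_prod_success q (∅ : Finset F)
  simp only [Finset.prod_empty, Finset.card_empty, pow_zero] at h1
  simpa [h1] using h

theorem biasedExpect_success (q : ℝ) (i : F) : biasedExpect q (success i) = q := by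
  simpa using biasedExpect_prod_success q {i}

theorem biasedExpect_success₂ (q : ℝ) {i k : F} (h : i ≠ k) :
    biasedExpect q (fun σ => success i σ * success k σ) = q ^ 2 := by
  have := biasedExpect_prod_success q {i, k}
  simpa [Finset.prod_pair h, Finset.card_pair h] using this

theorem biasedExpect_success₃ (q : ℝ) {i k l : F} (hik : i ≠ k) (hil : i ≠ l) (hkl : k ≠ l) :
    biasedExpect q (fun σ => success i σ * (success k σ * success l σ)) = q ^ 3 := by
  have := biasedExpect_prod_success q {i, k, l}
  rw [Finset.card_eq_three.mpr ⟨i, k, l, hik, hil, hkl, rfl⟩] at this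
  have h2 : ∀ σ, ∏ x ∈ ({i, k, l} : Finset F), success x σ =
      success i σ * (success k σ * success l σ) := by
    intro σ
    rw [Finset.prod_insert (by simp [hik, hil]), Finset.prod_pair hkl]
  simpa [h2] using this

theorem biasedExpect_le_of_forall_le {q : ℝ} (h0 : 0 ≤ q) (h1 : q ≤ 1) {g : (F → Bool) → ℝ} {c : ℝ}
    (h : ∀ σ, g σ ≤ c) : biasedExpect q g ≤ c :=
  (biasedExpect_mono h0 h1 h).trans_eq (biasedExpect_const q c)

/-- If `g ≤ c₁` when the first coin succeeds and `g ≤ D` always, then `E g ≤ q c₁ + (1 - q) D`. -/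
theorem biasedExpect_le_one {q : ℝ} (h0 : 0 ≤ q) (h1 : q ≤ 1) {g : (F → Bool) → ℝ} {c D : ℝ} {e : F}
    (hD : ∀ σ, g σ ≤ D) (he : ∀ σ, σ e = true → g σ ≤ c) :
    biasedExpect q g ≤ q * c + (1 - q) * D := by
  have h : ∀ σ, g σ ≤ D + (c - D) * success e σ := by
    intro σ
    unfold success
    by_cases hs : σ e = true
    · simpa [hs] using he σ hs
    · simpa [hs] using hD σ
  refine (biasedExpect_mono h0 h1 h).trans_eq ?_
  rw [biasedExpect_add, biasedExpect_const, biasedExpect_const_mul, biasedExpect_success]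
  ring

/-- The coins are consulted in order, `e` before `e'`: the bound is `c` if `e` succeeds, `c'` if
only `e'` does, `D` otherwise. This is a multilinear polynomial in the two indicators, whose
expectation is explicit. -/
theorem biasedExpect_le_two {q : ℝ} (h0 : 0 ≤ q) (h1 : q ≤ 1) {g : (F → Bool) → ℝ} {c c' D : ℝ}
    {e e' : F} (hne : e ≠ e') (hD : ∀ σ, g σ ≤ D) (he : ∀ σ, σ e = true → g σ ≤ c)
    (he' : ∀ σ, σ e' = true → g σ ≤ c') :
    biasedExpect q g ≤ q * c + (1 - q) * (q * c' + (1 - q) * D) := by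
  have h : ∀ σ, g σ ≤ D + (c - D) * success e σ + (c' - D) * success e' σ +
      (D - c') * (success e σ * success e' σ) := by
    intro σ
    unfold success
    by_cases hs : σ e = true
    · by_cases hs' : σ e' = true
      · have := he σ hs
        simp only [hs, hs', if_true]
        linarith
      · have := he σ hs
        simp [hs, hs', this]
    · by_cases hs' : σ e' = true
      · have := he' σ hs'
        simp [hs, hs', this]
      · simpa [hs, hs'] using hD σ
  refine (biasedExpect_mono h0 h1 h).trans_eq ?_
  rw [biasedExpect_add, biasedExpect_add, biasedExpect_add, biasedExpect_const,
    biasedExpect_const_mul, biasedExpect_const_mul, biasedExpect_const_mul, biasedExpect_success,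
    biasedExpect_success, biasedExpect_success₂ q hne]
  ring

/-- If `g ≤ c` as soon as one of three coins succeeds, and `g ≤ D` always, then
`E g ≤ c + (1 - q)³ (D - c)`. -/
theorem biasedExpect_le_three {q : ℝ} (h0 : 0 ≤ q) (h1 : q ≤ 1) {g : (F → Bool) → ℝ} {c D : ℝ}
    {e₁ e₂ e₃ : F} (h12 : e₁ ≠ e₂) (h13 : e₁ ≠ e₃) (h23 : e₂ ≠ e₃) (hD : ∀ σ, g σ ≤ D)
    (he₁ : ∀ σ, σ e₁ = true → g σ ≤ c) (he₂ : ∀ σ, σ e₂ = true → g σ ≤ c)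
    (he₃ : ∀ σ, σ e₃ = true → g σ ≤ c) :
    biasedExpect q g ≤ c + (1 - q) ^ 3 * (D - c) := by
  have h : ∀ σ, g σ ≤ D + (c - D) * success e₁ σ + (c - D) * success e₂ σ +
      (c - D) * success e₃ σ + (D - c) * (success e₁ σ * success e₂ σ) +
      (D - c) * (success e₁ σ * success e₃ σ) + (D - c) * (success e₂ σ * success e₃ σ) +
      (c - D) * (success e₁ σ * (success e₂ σ * success e₃ σ)) := by
    intro σ
    have a0 := hD σ
    have a1 := he₁ σ
    have a2 := he₂ σ
    have a3 := he₃ σ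
    unfold success
    by_cases hs1 : σ e₁ = true <;> by_cases hs2 : σ e₂ = true <;> by_cases hs3 : σ e₃ = true <;>
      simp only [hs1, hs2, hs3, if_true, forall_const] at a1 a2 a3 ⊢ <;> simp <;> linarith
  refine (biasedExpect_mono h0 h1 h).trans_eq ?_
  simp only [biasedExpect_add, biasedExpect_const, biasedExpect_const_mul, biasedExpect_success,
    biasedExpect_success₂ q h12, biasedExpect_success₂ q h13, biasedExpect_success₂ q h23,
    biasedExpect_success₃ q h12 h13 h23]
  ring

/-- The expectation of a sum over a set that contains each `i ∈ A` with probability `q`. -/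
theorem biasedExpect_sum_inter (q a : ℝ) (N I A : Finset F) (hIA : Disjoint I A) (v : F → ℝ) :
    biasedExpect q (fun σ => a - ∑ i ∈ N ∩ (I ∪ {i ∈ A | σ i = true}), v i) =
      a - ∑ i ∈ N ∩ I, v i - q * ∑ i ∈ N ∩ A, v i := by
  have h : ∀ σ : F → Bool, a - ∑ i ∈ N ∩ (I ∪ {i ∈ A | σ i = true}), v i =
      (a - ∑ i ∈ N ∩ I, v i) + ∑ i ∈ N ∩ A, (-v i) * success i σ := by
    intro σ
    have hd : Disjoint (N ∩ I) (N ∩ {i ∈ A | σ i = true}) :=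
      Finset.disjoint_of_subset_left Finset.inter_subset_right
        (Finset.disjoint_of_subset_right
          (Finset.inter_subset_right.trans (Finset.filter_subset _ _)) hIA)
    rw [Finset.inter_union_distrib_left, Finset.sum_union hd, Finset.inter_filter,
      Finset.sum_filter]
    simp only [success, mul_ite, mul_one, mul_zero]
    rw [sub_add_eq_sub_sub, sub_eq_add_neg _ (∑ _ ∈ N ∩ A, _), ← Finset.sum_neg_distrib]
    congr 1
    refine Finset.sum_congr rfl fun i _ => ?_
    split_ifs <;> simp
  simp only [h]
  rw [biasedExpect_add, biasedExpect_const, biasedExpect_sum]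
  simp only [biasedExpect_const_mul, biasedExpect_success]
  rw [← Finset.sum_mul, Finset.sum_neg_distrib]
  ring

end Expectation

/-! ### Sums over fair coins -/

section Flips

variable {F : Type*} [Fintype F] [DecidableEq F]

/-- Flipping the coin of `l` is an involution, so counting every outcome twice pairs it with its
flip. -/
theorem sum_flip (f : (F → Bool) → ℝ) (l : F) :
    2 * ∑ ω, f ω =
      ∑ ω, (f (Function.update ω l true) + f (Function.update ω l false)) := by
  have hinv : Function.Involutive (fun ω : F → Bool => Function.update ω l (!ω l)) := by
    intro ω
    simp
  have h := Equiv.sum_comp hinv.toPerm f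
  rw [two_mul]
  nth_rewrite 2 [← h]
  rw [← Finset.sum_add_distrib]
  refine Finset.sum_congr rfl fun ω _ => ?_
  simp only [Function.Involutive.coe_toPerm]
  rcases hb : ω l with _ | _
  · have : Function.update ω l false = ω := by rw [← hb]; exact Function.update_eq_self l ω
    rw [this, add_comm]; rfl
  · have : Function.update ω l true = ω := by rw [← hb]; exact Function.update_eq_self l ω
    rw [this]; rfl

theorem sum_nonneg_of_flip {f : (F → Bool) → ℝ} (l : F)
    (h : ∀ ω, 0 ≤ f (Function.update ω l true) + f (Function.update ω l false)) :
    0 ≤ ∑ ω, f ω := by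
  have h1 := sum_flip f l
  have h2 := Finset.sum_nonneg fun ω (_ : ω ∈ Finset.univ) => h ω
  linarith

theorem sum_nonneg_of_flip_flip {f : (F → Bool) → ℝ} (l m : F)
    (h : ∀ ω, 0 ≤ f (Function.update (Function.update ω l true) m true) +
      f (Function.update (Function.update ω l true) m false) +
      (f (Function.update (Function.update ω l false) m true) +
      f (Function.update (Function.update ω l false) m false))) :
    0 ≤ ∑ ω, f ω := by
  have h1 := sum_flip f m
  have h2 := sum_nonneg_of_flip
    (f := fun ω => f (Function.update ω m true) + f (Function.update ω m false)) l h
  linarith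

end Flips

/-! ### Costs -/

section Cost

variable {d : ℕ} {F : Type*}

theorem cost_nonneg (x y : EuclideanSpace ℝ (Fin d)) : 0 ≤ cost x y := sq_nonneg _

theorem cost_comm (x y : EuclideanSpace ℝ (Fin d)) : cost x y = cost y x := by
  unfold cost; rw [dist_comm]

theorem sqrt_cost (x y : EuclideanSpace ℝ (Fin d)) : √(cost x y) = dist x y :=
  Real.sqrt_sq dist_nonneg

theorem sqrt_cost_triangle (x y z : EuclideanSpace ℝ (Fin d)) :
    √(cost x z) ≤ √(cost x y) + √(cost y z) := by
  simp only [sqrt_cost]; exact dist_triangle x y z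

variable (fac : F → EuclideanSpace ℝ (Fin d)) (z : EuclideanSpace ℝ (Fin d))

theorem costTo_le {S : Finset F} {i : F} (hi : i ∈ S) : costTo fac z S ≤ cost z (fac i) := by
  unfold costTo
  exact ciInf_le (f := fun k : S => cost z (fac k)) (Set.finite_range _).bddBelow ⟨i, hi⟩

/-- Nonemptiness of `S` matters: a real infimum over an empty family is `0`. -/
theorem costTo_anti {S T : Finset F} (hS : S.Nonempty) (h : S ⊆ T) :
    costTo fac z T ≤ costTo fac z S := by
  have : Nonempty S := hS.to_subtype
  exact le_ciInf fun i => costTo_le fac z (h i.2)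

theorem costTo_nonneg (S : Finset F) : 0 ≤ costTo fac z S :=
  Real.iInf_nonneg fun _ => cost_nonneg _ _

/-- The weighted form of the fact that the sum of the squared distances to a point is at least the
sum of all squared pairwise distances divided by the number of points. -/
theorem sum_mul_cost_pairs_le (T : Finset F) (w : F → ℝ) :
    ∑ i ∈ T, ∑ k ∈ T, w i * w k * cost (fac i) (fac k) ≤
      2 * (∑ i ∈ T, w i) * ∑ i ∈ T, w i * cost z (fac i) := by
  have hpt : ∀ i k, cost (fac i) (fac k) = cost z (fac i) + cost z (fac k)
      - 2 * inner ℝ (fac i - z) (fac k - z) := by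
    intro i k
    unfold cost
    rw [dist_comm z, dist_comm z, dist_eq_norm, dist_eq_norm, dist_eq_norm,
      ← sub_sub_sub_cancel_right (fac i) (fac k) z, norm_sub_sq_real]
    ring
  -- With `z` as origin, the two sides of the inequality differ by twice the squared norm of the
  -- weighted sum of the vectors `fac i - z`.
  have h1 : ∑ i ∈ T, ∑ k ∈ T, w i * w k * cost (fac i) (fac k) =
      2 * (∑ i ∈ T, w i) * ∑ i ∈ T, w i * cost z (fac i)
      - 2 * inner ℝ (∑ i ∈ T, w i • (fac i - z)) (∑ i ∈ T, w i • (fac i - z)) := by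
    simp only [hpt, sum_inner, inner_sum, inner_smul_left, inner_smul_right]
    have e1 : (∑ i ∈ T, w i) * ∑ i ∈ T, w i * cost z (fac i) =
        ∑ i ∈ T, ∑ k ∈ T, w i * (w k * cost z (fac k)) := Finset.sum_mul_sum _ _ _ _
    have e2 : (∑ i ∈ T, w i) * ∑ i ∈ T, w i * cost z (fac i) =
        ∑ i ∈ T, ∑ k ∈ T, w k * (w i * cost z (fac i)) := by
      rw [e1, Finset.sum_comm]
    have e3 : 2 * (∑ i ∈ T, w i) * ∑ i ∈ T, w i * cost z (fac i) =
        ∑ i ∈ T, ∑ k ∈ T, (w i * (w k * cost z (fac k)) + w k * (w i * cost z (fac i))) := by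
      simp only [Finset.sum_add_distrib]
      rw [← e1, ← e2]; ring
    rw [e3, Finset.mul_sum, ← Finset.sum_sub_distrib]
    refine Finset.sum_congr rfl fun i _ => ?_
    rw [Finset.mul_sum, Finset.mul_sum, ← Finset.sum_sub_distrib]
    refine Finset.sum_congr rfl fun k _ => ?_
    rw [real_inner_comm (fac k - z)]
    simp only [conj_trivial]
    ring
  have h2 : 0 ≤ inner ℝ (∑ i ∈ T, w i • (fac i - z)) (∑ i ∈ T, w i • (fac i - z)) :=
    real_inner_self_nonneg
  rw [h1]
  linarith

/-- Points `A ∪ B` of pairwise squared distance at least `2α`, and at least `δα` inside `A`, with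
weight `u` on `A` and weight `q` on `B`. -/
theorem weighted_sum_cost_ge [DecidableEq F] {A B : Finset F} (hAB : Disjoint A B) {α δ u q : ℝ}
    (hu : 0 ≤ u) (hq : 0 ≤ q)
    (hpair : ∀ i ∈ A ∪ B, ∀ k ∈ A ∪ B, i ≠ k → 2 * α ≤ cost (fac i) (fac k))
    (hA : ∀ i ∈ A, ∀ k ∈ A, i ≠ k → δ * α ≤ cost (fac i) (fac k)) :
    α * ((u * A.card + q * B.card) ^ 2 - (u ^ 2 * A.card + q ^ 2 * B.card)
        + (δ / 2 - 1) * u ^ 2 * (A.card * (A.card - 1))) ≤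
      (u * A.card + q * B.card) *
        (u * ∑ i ∈ A, cost z (fac i) + q * ∑ i ∈ B, cost z (fac i)) := by
  have hnA : ∀ {i}, i ∈ B → i ∉ A := fun hi hA => Finset.disjoint_left.mp hAB hA hi
  -- Only the `|X|(|X| - 1)` ordered pairs off the diagonal carry a lower bound.
  have hd : ∀ (X : Finset F) (c : ℝ), ∑ i ∈ X, ∑ k ∈ X, (if i = k then 0 else c) =
      c * (X.card * (X.card - 1)) := by
    intro X c
    have : ∀ i ∈ X, ∑ k ∈ X, (if i = k then 0 else c) = c * (X.card - 1) := by
      intro i hi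
      have : ∀ k, (if i = k then 0 else c) = c - if i = k then c else 0 := by
        intro k; split_ifs <;> simp
      simp only [this]
      rw [Finset.sum_sub_distrib, Finset.sum_ite_eq, if_pos hi, Finset.sum_const, nsmul_eq_mul]
      ring
    rw [Finset.sum_congr rfl this, Finset.sum_const, nsmul_eq_mul]; ring
  have hmain := sum_mul_cost_pairs_le fac z (A ∪ B) (fun i => if i ∈ A then u else q)
  have ew : ∀ g : F → ℝ, ∑ i ∈ A ∪ B, (if i ∈ A then u else q) * g i =
      u * ∑ i ∈ A, g i + q * ∑ i ∈ B, g i := by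
    intro g
    rw [Finset.sum_union hAB, Finset.mul_sum, Finset.mul_sum]
    congr 1
    · exact Finset.sum_congr rfl fun i hi => by rw [if_pos hi]
    · exact Finset.sum_congr rfl fun i hi => by rw [if_neg (hnA hi)]
  have e1 : ∑ i ∈ A ∪ B, (if i ∈ A then u else q) = u * A.card + q * B.card := by
    have := ew (fun _ => 1)
    simpa using this
  rw [e1, ew] at hmain
  have hlow : ∑ i ∈ A ∪ B, ∑ k ∈ A ∪ B,
      (if i ∈ A then u else q) * (if k ∈ A then u else q) * cost (fac i) (fac k) =
      u * u * (∑ i ∈ A, ∑ k ∈ A, cost (fac i) (fac k)) +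
      u * q * (∑ i ∈ A, ∑ k ∈ B, cost (fac i) (fac k)) +
      u * q * (∑ i ∈ B, ∑ k ∈ A, cost (fac i) (fac k)) +
      q * q * (∑ i ∈ B, ∑ k ∈ B, cost (fac i) (fac k)) := by
    have : ∀ i, ∑ k ∈ A ∪ B, (if i ∈ A then u else q) * (if k ∈ A then u else q) *
        cost (fac i) (fac k) = (if i ∈ A then u else q) *
        (u * ∑ k ∈ A, cost (fac i) (fac k) + q * ∑ k ∈ B, cost (fac i) (fac k)) := by
      intro i
      rw [← ew, Finset.mul_sum]
      exact Finset.sum_congr rfl fun k _ => by ring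
    simp only [this]
    rw [ew]
    simp only [Finset.sum_add_distrib, ← Finset.mul_sum]
    ring
  have hAA : δ * α * (A.card * (A.card - 1)) ≤ ∑ i ∈ A, ∑ k ∈ A, cost (fac i) (fac k) := by
    rw [← hd]
    refine Finset.sum_le_sum fun i hi => Finset.sum_le_sum fun k hk => ?_
    split_ifs with h
    · exact cost_nonneg _ _
    · exact hA i hi k hk h
  have hBB : 2 * α * (B.card * (B.card - 1)) ≤ ∑ i ∈ B, ∑ k ∈ B, cost (fac i) (fac k) := by
    rw [← hd]
    refine Finset.sum_le_sum fun i hi => Finset.sum_le_sum fun k hk => ?_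
    split_ifs with h
    · exact cost_nonneg _ _
    · exact hpair i (Finset.mem_union_right _ hi) k (Finset.mem_union_right _ hk) h
  have hABs : A.card * (B.card * (2 * α)) ≤ ∑ i ∈ A, ∑ k ∈ B, cost (fac i) (fac k) := by
    rw [← nsmul_eq_mul, ← Finset.sum_const]
    refine Finset.sum_le_sum fun i hi => ?_
    rw [← nsmul_eq_mul, ← Finset.sum_const]
    refine Finset.sum_le_sum fun k hk => ?_
    exact hpair i (Finset.mem_union_left _ hi) k (Finset.mem_union_right _ hk)
      (fun h => hnA hk (h ▸ hi))
  have hBAs : A.card * (B.card * (2 * α)) ≤ ∑ i ∈ B, ∑ k ∈ A, cost (fac i) (fac k) := by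
    rw [Finset.sum_comm]
    simpa only [cost_comm] using hABs
  rw [hlow] at hmain
  have m1 := mul_le_mul_of_nonneg_left hAA (mul_nonneg hu hu)
  have m2 := mul_le_mul_of_nonneg_left hABs (mul_nonneg hu hq)
  have m3 := mul_le_mul_of_nonneg_left hBAs (mul_nonneg hu hq)
  have m4 := mul_le_mul_of_nonneg_left hBB (mul_nonneg hq hq)
  nlinarith [m1, m2, m3, m4, hmain]

end Cost

/-! ### Averaging over the fair coins

Every candidate center `i` is controlled by the fair coin of `κ i` and can be chosen only if that coin
shows `π i`. -/

section Averaging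

variable {F : Type*}

/-- The elements of `N` that may be chosen when the fair coins show `ω`. -/
def active (κ : F → F) (π : F → Bool) (N : Finset F) (ω : F → Bool) : Finset F :=
  {i ∈ N | ω (κ i) = π i}

theorem mem_active {κ : F → F} {π : F → Bool} {N : Finset F} {ω : F → Bool} {i : F} :
    i ∈ active κ π N ω ↔ i ∈ N ∧ ω (κ i) = π i := by
  simp [active]

variable [DecidableEq F] in
theorem mem_active_update {κ : F → F} {π : F → Bool} {N : Finset F} {ω : F → Bool} {l i : F}
    {b : Bool} : i ∈ active κ π N (Function.update ω l b) ↔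
      i ∈ N ∧ (if κ i = l then b else ω (κ i)) = π i := by
  simp [active, Function.update_apply]

variable [DecidableEq F] in
theorem mem_active_update_update {κ : F → F} {π : F → Bool} {N : Finset F} {ω : F → Bool}
    {l m i : F} {b b' : Bool} :
    i ∈ active κ π N (Function.update (Function.update ω l b) m b') ↔
      i ∈ N ∧ (if κ i = m then b' else if κ i = l then b else ω (κ i)) = π i := by
  simp [active, Function.update_apply]

/-- Lower bounds on the slack `f` of a client as a function of the fair coins `ω`, depending on the
set of active elements of its neighbourhood `N`; `P` is the set of all candidate centers. -/
structure SlackBounds (κ : F → F) (π : F → Bool) (P N : Finset F) (x : F → ℝ) (M D q Φ : ℝ)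
    (f : (F → Bool) → ℝ) : Prop where
  one_le : 1 ≤ M
  q_nonneg : 0 ≤ q
  q_le_one : q ≤ 1
  x_nonneg : ∀ i, 0 ≤ x i
  zero : ∀ ω, active κ π N ω = ∅ → M - D ≤ f ω
  zero_add : ∀ ω, active κ π N ω = ∅ → ∀ i ∈ active κ π P ω, M - (q * x i + (1 - q) * D) ≤ f ω
  one : ∀ ω i, active κ π N ω = {i} →
    M * (1 - q + q * x i) - (q * x i + (1 - q) * D) ≤ f ω
  one_add : ∀ ω i, active κ π N ω = {i} → ∀ k ∈ active κ π P ω, k ≠ i →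
    M * (1 - q + q * x i) - (q * x i + (1 - q) * (q * x k + (1 - q) * D)) ≤ f ω
  two : ∀ ω, 1 < (active κ π N ω).card → Φ ≤ f ω
  Φ_nonneg : 0 ≤ Φ

variable {κ : F → F} {π : F → Bool} {P N : Finset F} {x : F → ℝ} {M D q Φ : ℝ}
  {f : (F → Bool) → ℝ}

namespace SlackBounds

theorem excess_nonneg (h : SlackBounds κ π P N x M D q Φ f) (i : F) : 0 ≤ (M - 1) * (q * x i) :=
  mul_nonneg (sub_nonneg.mpr h.one_le) (mul_nonneg h.q_nonneg (h.x_nonneg i))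

/-- The three mixtures met in the averaging: `θ = q/2` when the fair coin of `k` is averaged out, `θ
= q` when `k` is active, and `θ = q/(2 - q)` when `k` is active on one side of a flip and a single
neighbour on the other. -/
theorem mix_le (h : SlackBounds κ π P N x M D q Φ f) {k : F}
    (hθ : ∀ θ : ℝ, q / 2 ≤ θ → θ ≤ 1 → θ * x k + (1 - θ) * D ≤ M) :
    q * x k + (2 - q) * D ≤ 2 * M ∧ q * x k + (1 - q) * D ≤ M ∧
      q * x k + 2 * ((1 - q) * D) ≤ (2 - q) * M := by
  have h0 := h.q_nonneg
  have h1 := h.q_le_one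
  refine ⟨?_, ?_, ?_⟩
  · have := hθ (q / 2) le_rfl (by linarith)
    linarith
  · exact hθ q (by linarith) h1
  · have hpos : 0 < 2 - q := by linarith
    have := hθ (q / (2 - q)) (by
      rw [div_le_div_iff₀ two_pos hpos]; nlinarith) (by rw [div_le_one hpos]; linarith)
    have e : q / (2 - q) * x k + (1 - q / (2 - q)) * D =
        (q * x k + 2 * ((1 - q) * D)) / (2 - q) := by
      field_simp; ring
    rw [e, div_le_iff₀ hpos] at this
    linarith

variable [Fintype F] [DecidableEq F]

/-- If `D ≤ M`, no outcome has negative slack and no pairing is needed. -/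
theorem sum_nonneg_of_le (h : SlackBounds κ π P N x M D q Φ f) (hD : D ≤ M) : 0 ≤ ∑ ω, f ω := by
  refine Finset.sum_nonneg fun ω _ => ?_
  rcases (active κ π N ω).card.eq_zero_or_pos with h0 | h0
  · have := h.zero ω (Finset.card_eq_zero.mp h0)
    linarith
  rcases Nat.lt_or_eq_of_le h0 with h1 | h1
  · exact h.Φ_nonneg.trans (h.two ω h1)
  · obtain ⟨i, hi⟩ := Finset.card_eq_one.mp h1.symm
    have := h.one ω i hi
    have h2 := h.excess_nonneg i
    have h3 := mul_nonneg (sub_nonneg.mpr h.q_le_one) (sub_nonneg.mpr hD)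
    nlinarith

/-- Two elements of `N` controlled by the same coin with opposite polarity. -/
theorem sum_nonneg_of_opposite (h : SlackBounds κ π P N x M D q Φ f)
    (hΦ₁ : 0 ≤ Φ + (1 - q) * (M - D)) {e g : F} (he : e ∈ N) (hg : g ∈ N) (hκ : κ g = κ e)
    (hπe : π e = true) (hπg : π g = false)
    (huniq : ∀ i ∈ N, κ i = κ e → π i = true → i = e)
    (hopp : ∀ g ∈ N, κ g = κ e → π g = false →
      0 ≤ 2 * ((1 - q) * (M - D)) + (M - 1) * (q * (x e + x g))) :
    0 ≤ ∑ ω, f ω := by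
  refine sum_nonneg_of_flip (κ e) fun ω => ?_
  have het : e ∈ active κ π N (Function.update ω (κ e) true) := by
    rw [mem_active_update]; simp [he, hπe]
  have hgf : g ∈ active κ π N (Function.update ω (κ e) false) := by
    rw [mem_active_update]; simp [hg, hπg, hκ]
  -- A further active neighbour on another coin makes at least two active on both sides of the flip.
  -- Without one, `e` is alone on its side, and `g` is alone or accompanied on the other.
  by_cases hK : ∃ i ∈ N, κ i ≠ κ e ∧ ω (κ i) = π i
  · obtain ⟨i, hi, hie, hiω⟩ := hK
    have hm : ∀ b, i ∈ active κ π N (Function.update ω (κ e) b) := by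
      intro b; rw [mem_active_update]; simp [hi, hie, hiω]
    have h1 := h.two _ (Finset.one_lt_card.mpr ⟨i, hm true, e, het, fun h => hie (h ▸ rfl)⟩)
    have h2 := h.two _ (Finset.one_lt_card.mpr ⟨i, hm false, g, hgf, fun h => hie (h ▸ hκ)⟩)
    linarith [h.Φ_nonneg]
  · push Not at hK
    have h1 := h.one (Function.update ω (κ e) true) e (by
      refine Finset.eq_singleton_iff_unique_mem.mpr ⟨het, fun i hi => ?_⟩
      rw [mem_active_update] at hi
      by_cases hie : κ i = κ e
      · exact huniq i hi.1 hie (by simpa [hie] using hi.2.symm)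
      · exact absurd (by simpa [hie] using hi.2) (hK i hi.1 hie))
    by_cases hg2 : ∃ g' ∈ active κ π N (Function.update ω (κ e) false), g' ≠ g
    · obtain ⟨g', hg', hne⟩ := hg2
      have h2 := h.two _ (Finset.one_lt_card.mpr ⟨g', hg', g, hgf, hne⟩)
      have h3 := h.excess_nonneg e
      linarith
    · push Not at hg2
      have h2 := h.one _ g (Finset.eq_singleton_iff_unique_mem.mpr ⟨hgf, hg2⟩)
      have h3 := hopp g hg hκ hπg
      linarith

/-- Two elements of `N` controlled by different coins. -/
theorem sum_nonneg_of_two_coins (h : SlackBounds κ π P N x M D q Φ f)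
    (hΦ₁ : 0 ≤ Φ + (1 - q) * (M - D))
    (hΦ₂ : 0 ≤ Φ + (2 - q) * (M - D) + (M - 1) * (q * (3 - 2 * √2)))
    (hΦ₃ : 0 ≤ Φ + (3 - 2 * q) * (M - D) + (M - 1) * q)
    {e e' : F} (he : e ∈ N) (he' : e' ∈ N) (hκ : κ e' ≠ κ e) (hπe : π e = true)
    (hsing : ∀ i ∈ N, κ i = κ e → i = e) (hgrp : ∀ i ∈ N, κ i = κ e' → π i = π e')
    (hx : 3 - 2 * √2 ≤ x e) (hxx : 1 ≤ x e + x e') :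
    0 ≤ ∑ ω, f ω := by
  have hM := sub_nonneg.mpr h.one_le
  have key : ∀ ω : F → Bool,
      0 ≤ f (Function.update (Function.update ω (κ e) true) (κ e') (π e')) +
        f (Function.update (Function.update ω (κ e) true) (κ e') (!π e')) +
        (f (Function.update (Function.update ω (κ e) false) (κ e') (π e')) +
        f (Function.update (Function.update ω (κ e) false) (κ e') (!π e'))) := by
    intro ω
    have het : ∀ b, e ∈ active κ π N
        (Function.update (Function.update ω (κ e) true) (κ e') b) := by
      intro b; rw [mem_active_update_update]; simp [he, hπe, hκ.symm]
    have hgt : ∀ b, e' ∈ active κ π N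
        (Function.update (Function.update ω (κ e) b) (κ e') (π e')) := by
      intro b; rw [mem_active_update_update]; simp [he']
    have hee : e ≠ e' := fun h => hκ (h ▸ rfl)
    have hrest : ∀ k ∈ N, κ k ≠ κ e → κ k ≠ κ e' → ω (κ k) = π k → ∀ b b', k ∈ active κ π N
        (Function.update (Function.update ω (κ e) b) (κ e') b') := by
      intro k hk h1 h2 h3 b b'; rw [mem_active_update_update]; simp [hk, h1, h2, h3]
    have hoff : ∀ k, k ∈ active κ π N
        (Function.update (Function.update ω (κ e) false) (κ e') (!π e')) →
        k ∈ N ∧ κ k ≠ κ e ∧ κ k ≠ κ e' ∧ ω (κ k) = π k := by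
      intro k hk
      rw [mem_active_update_update] at hk
      obtain ⟨hkN, hk⟩ := hk
      by_cases h2 : κ k = κ e'
      · rw [if_pos h2, hgrp k hkN h2] at hk
        simp at hk
      by_cases h1 : κ k = κ e
      · rw [if_neg h2, if_pos h1, hsing k hkN h1, hπe] at hk
        simp at hk
      rw [if_neg h2, if_neg h1] at hk
      exact ⟨hkN, h1, h2, hk⟩
    have hHB := h.two _ (Finset.one_lt_card.mpr ⟨e, het _, e', hgt _, hee⟩)
    -- With an active neighbour `k` on a third coin, only the outcome with `e` and `e'` both off can
    -- have a single active neighbour, and `hΦ₁` pays for it. Without one, the four outcomes have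
    -- both active, only `e`, the group of `e'`, and none; `hΦ₂` or `hΦ₃` applies according to
    -- whether `e'` is accompanied.
    by_cases hK : ∃ k ∈ N, κ k ≠ κ e ∧ κ k ≠ κ e' ∧ ω (κ k) = π k
    · obtain ⟨k, hk, h1, h2, h3⟩ := hK
      have hkm := hrest k hk h1 h2 h3
      have hHN := h.two _ (Finset.one_lt_card.mpr
        ⟨e, het _, k, hkm true (!π e'), fun h => h1 (h ▸ rfl)⟩)
      have hTB := h.two _ (Finset.one_lt_card.mpr
        ⟨e', hgt _, k, hkm false (π e'), fun h => h2 (h ▸ rfl)⟩)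
      by_cases hk2 : ∃ k' ∈ active κ π N
          (Function.update (Function.update ω (κ e) false) (κ e') (!π e')), k' ≠ k
      · obtain ⟨k', hk', hne⟩ := hk2
        have hTN := h.two _ (Finset.one_lt_card.mpr ⟨k', hk', k, hkm _ _, hne⟩)
        linarith [h.Φ_nonneg]
      · push Not at hk2
        have hTN := h.one _ k (Finset.eq_singleton_iff_unique_mem.mpr ⟨hkm _ _, hk2⟩)
        linarith [h.Φ_nonneg, h.excess_nonneg k]
    · push Not at hK
      have hTN := h.zero (Function.update (Function.update ω (κ e) false) (κ e') (!π e')) (by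
        refine Finset.eq_empty_of_forall_notMem fun k hk => ?_
        obtain ⟨a, b, c, d⟩ := hoff k hk
        exact hK k a b c d)
      have hHN := h.one (Function.update (Function.update ω (κ e) true) (κ e') (!π e')) e (by
        refine Finset.eq_singleton_iff_unique_mem.mpr ⟨het _, fun k hk => ?_⟩
        by_cases h1 : κ k = κ e
        · exact hsing k (mem_active.mp hk).1 h1
        · exfalso
          obtain ⟨a, b, c, d⟩ := hoff k (by
            rw [mem_active_update_update] at hk ⊢
            simpa [h1] using hk)
          exact hK k a b c d)
      have hqx : q * (3 - 2 * √2) ≤ q * x e := mul_le_mul_of_nonneg_left hx h.q_nonneg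
      have hqxx : q * 1 ≤ q * (x e + x e') := mul_le_mul_of_nonneg_left hxx h.q_nonneg
      have m1 := mul_le_mul_of_nonneg_left hqx hM
      have m2 := mul_le_mul_of_nonneg_left hqxx hM
      by_cases hk2 : ∃ k' ∈ active κ π N
          (Function.update (Function.update ω (κ e) false) (κ e') (π e')), k' ≠ e'
      · obtain ⟨k', hk', hne⟩ := hk2
        have hTB := h.two _ (Finset.one_lt_card.mpr ⟨k', hk', e', hgt _, hne⟩)
        linarith [h.Φ_nonneg]
      · push Not at hk2
        have hTB := h.one _ e' (Finset.eq_singleton_iff_unique_mem.mpr ⟨hgt _, hk2⟩)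
        linarith
  -- `key` orders the outcomes of the second coin as "`π e'`, then its negation"; the case split
  -- restores the order "`true`, then `false`".
  refine sum_nonneg_of_flip_flip (κ e) (κ e') fun ω => ?_
  have := key ω
  rcases hb : π e' with _ | _ <;> rw [hb] at this <;>
    simp only [Bool.not_true, Bool.not_false] at this <;> linarith

/-- The set `N` has one element `e`; either `D` is small compared with `x e`, or there is another
candidate `k` whose distance is under control. -/
theorem sum_nonneg_of_singleton {e : F} (h : SlackBounds κ π P {e} x M D q Φ f) (hπe : π e = true)
    (hcase : 0 ≤ (2 - q) * (M - D) + (M - 1) * (q * x e) ∨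
      ∃ k ∈ P, k ≠ e ∧ (κ k = κ e → π k = false) ∧
        ∀ θ : ℝ, q / 2 ≤ θ → θ ≤ 1 → θ * x k + (1 - θ) * D ≤ M) :
    0 ≤ ∑ ω, f ω := by
  have on_iff : ∀ ω : F → Bool, ω (κ e) = true → active κ π {e} ω = {e} := by
    intro ω hω; ext i; rw [mem_active]; simp only [Finset.mem_singleton]
    refine ⟨fun hi => hi.1, fun hi => ⟨hi, ?_⟩⟩
    rw [hi, hω, hπe]
  have off_iff : ∀ ω : F → Bool, ω (κ e) = false → active κ π {e} ω = ∅ := by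
    intro ω hω; ext i; rw [mem_active]; simp only [Finset.mem_singleton, Finset.notMem_empty,
      iff_false, not_and]
    rintro rfl; rw [hω, hπe]; simp
  have hex := h.excess_nonneg e
  -- In the first case the two outcomes of the coin of `e` balance. In the second, `k` on the same
  -- coin is active exactly when `e` is not; on a different coin, four outcomes are averaged.
  rcases hcase with hc | ⟨k, hk, hke, hpol, hθ⟩
  · refine sum_nonneg_of_flip (κ e) fun ω => ?_
    have h1 := h.one (Function.update ω (κ e) true) e (on_iff _ (by simp))
    have h2 := h.zero (Function.update ω (κ e) false) (off_iff _ (by simp))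
    linarith
  · obtain ⟨m1, m2, m3⟩ := h.mix_le hθ
    by_cases hκ : κ k = κ e
    · refine sum_nonneg_of_flip (κ e) fun ω => ?_
      have h1 := h.one (Function.update ω (κ e) true) e (on_iff _ (by simp))
      have h2 := h.zero_add (Function.update ω (κ e) false) (off_iff _ (by simp)) k (by
        rw [mem_active_update]; simp [hk, hκ, hpol hκ])
      linarith
    · have key : ∀ ω : F → Bool,
          0 ≤ f (Function.update (Function.update ω (κ e) true) (κ k) (π k)) +
            f (Function.update (Function.update ω (κ e) true) (κ k) (!π k)) +
            (f (Function.update (Function.update ω (κ e) false) (κ k) (π k)) +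
            f (Function.update (Function.update ω (κ e) false) (κ k) (!π k))) := by
        intro ω
        have hkm : ∀ b, k ∈ active κ π P
            (Function.update (Function.update ω (κ e) b) (κ k) (π k)) := by
          intro b; rw [mem_active_update_update]; simp [hk]
        have hv : ∀ b b', Function.update (Function.update ω (κ e) b) (κ k) b' (κ e) = b := by
          intro b b'; rw [Function.update_of_ne (Ne.symm hκ)]; simp
        have h1 := h.one_add _ e (on_iff _ (hv true (π k))) k (hkm true) hke
        have h2 := h.one _ e (on_iff _ (hv true (!π k)))
        have h3 := h.zero_add _ (off_iff _ (hv false (π k))) k (hkm false)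
        have h4 := h.zero _ (off_iff _ (hv false (!π k)))
        have m4 := mul_le_mul_of_nonneg_left m1 (sub_nonneg.mpr h.q_le_one)
        linarith
      refine sum_nonneg_of_flip_flip (κ e) (κ k) fun ω => ?_
      have := key ω
      rcases hb : π k with _ | _ <;> rw [hb] at this <;>
        simp only [Bool.not_true, Bool.not_false] at this <;> linarith

/-- All elements of `N` have polarity `false`, and there is a candidate `k` outside of `N` of polarity
`true` whose distance is under control. -/
theorem sum_nonneg_of_all_false (h : SlackBounds κ π P N x M D q Φ f) (hN : ∀ i ∈ N, π i = false)
    {k : F} (hk : k ∈ P) (hkN : k ∉ N) (hπk : π k = true)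
    (hθ : ∀ θ : ℝ, q / 2 ≤ θ → θ ≤ 1 → θ * x k + (1 - θ) * D ≤ M) :
    0 ≤ ∑ ω, f ω := by
  have hr := sub_nonneg.mpr h.q_le_one
  have hΦ := h.Φ_nonneg
  obtain ⟨m1, m2, m3⟩ := h.mix_le hθ
  refine sum_nonneg_of_flip (κ k) fun ω => ?_
  have hkm : k ∈ active κ π P (Function.update ω (κ k) true) := by
    rw [mem_active_update]; simp [hk, hπk]
  -- Turning the coin of `k` to `true` activates `k` and can only deactivate neighbours, all of
  -- which have polarity `false`.
  have hsub : active κ π N (Function.update ω (κ k) true) ⊆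
      active κ π N (Function.update ω (κ k) false) := by
    intro i hi
    rw [mem_active_update] at hi ⊢
    refine ⟨hi.1, ?_⟩
    by_cases hik : κ i = κ k
    · simp [hik, hN i hi.1]
    · simpa [hik] using hi.2
  rcases (active κ π N (Function.update ω (κ k) true)).eq_empty_or_nonempty with h0 | ⟨i, hi⟩
  · have h1 := h.zero_add _ h0 k hkm
    rcases (active κ π N (Function.update ω (κ k) false)).eq_empty_or_nonempty with h2 | ⟨g, hg⟩
    · have h3 := h.zero _ h2
      linarith
    · by_cases hg2 : ∃ g' ∈ active κ π N (Function.update ω (κ k) false), g' ≠ g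
      · obtain ⟨g', hg', hne⟩ := hg2
        have h3 := h.two _ (Finset.one_lt_card.mpr ⟨g', hg', g, hg, hne⟩)
        linarith
      · push Not at hg2
        have h3 := h.one _ g (Finset.eq_singleton_iff_unique_mem.mpr ⟨hg, hg2⟩)
        linarith [h.excess_nonneg g]
  · have hex := h.excess_nonneg i
    by_cases hi2 : ∃ i' ∈ active κ π N (Function.update ω (κ k) true), i' ≠ i
    · obtain ⟨i', hi', hne⟩ := hi2
      have h1 := h.two _ (Finset.one_lt_card.mpr ⟨i', hi', i, hi, hne⟩)
      have h2 := h.two _ (Finset.one_lt_card.mpr ⟨i', hsub hi', i, hsub hi, hne⟩)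
      linarith
    · push Not at hi2
      have h1 := h.one_add _ i (Finset.eq_singleton_iff_unique_mem.mpr ⟨hi, hi2⟩) k hkm
        (fun e => hkN (e ▸ (mem_active.mp hi).1))
      by_cases hg2 : ∃ g' ∈ active κ π N (Function.update ω (κ k) false), g' ≠ i
      · obtain ⟨g', hg', hne⟩ := hg2
        have h3 := h.two _ (Finset.one_lt_card.mpr ⟨g', hg', i, hsub hi, hne⟩)
        have m4 := mul_le_mul_of_nonneg_left m2 hr
        linarith
      · push Not at hg2
        have h3 := h.one _ i (Finset.eq_singleton_iff_unique_mem.mpr ⟨hsub hi, hg2⟩)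
        have m4 := mul_le_mul_of_nonneg_left m1 hr
        linarith

end SlackBounds

end Averaging

/-! ### Numerical estimates -/

section Numerics

/-- The guarantee when the neighbourhood of the client is empty and a second-level center is near the
witness. -/
def mixBound (δ₁ p : ℝ) : ℝ := 1 + 2 * p + (1 - p) * δ₁ + 2 * √(2 * p ^ 2 + (1 - p) * δ₁)

/-- The guarantee when one second-level center lies in the neighbourhood of the client. -/
def singleBound (δ₁ δ₃ p : ℝ) : ℝ :=
  ((1 - p) * (1 + √δ₁) ^ 2 + p * (1 - √δ₃) ^ 2) / (1 - p + p * (1 - √δ₃) ^ 2)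

/-- The guarantee when a second-level center and one of its third-level centers lie in the
neighbourhood of the client. -/
def oppositeBound (δ₁ δ₃ p : ℝ) : ℝ :=
  ((1 - 2 * p) * (1 + √δ₁) ^ 2 * (δ₁ + (√δ₁ + √δ₃) ^ 2) + p * (1 + √δ₁) ^ 2 * δ₃) /
    ((1 - 2 * p) * (δ₁ + (√δ₁ + √δ₃) ^ 2) + p * (1 + √δ₁) ^ 2 * δ₃)

theorem sqrt_two_bounds : 1.41421 < √2 ∧ √2 < 1.41422 := by
  constructor
  · rw [Real.lt_sqrt (by norm_num)]; norm_num
  · rw [Real.sqrt_lt' (by norm_num)]; norm_num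

theorem sqrt_delta_one_bounds {δ₁ : ℝ} (h : δ₁ = (4 + 8 * √2) / 7) :
    1.479 < √δ₁ ∧ √δ₁ < 1.4791 ∧ 2.1876 < δ₁ ∧ δ₁ < 2.1877 := by
  obtain ⟨h1, h2⟩ := sqrt_two_bounds
  have h3 : 2.1876 < δ₁ := by rw [h]; linarith
  have h4 : δ₁ < 2.1877 := by rw [h]; linarith
  refine ⟨?_, ?_, h3, h4⟩
  · rw [Real.lt_sqrt (by norm_num)]; norm_num; linarith
  · rw [Real.sqrt_lt' (by norm_num)]; norm_num; linarith

theorem sqrt_delta_three_bounds {δ₃ : ℝ} (h : δ₃ = 6 - 4 * √2 ∨ δ₃ = 0.265) :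
    0.51 < √δ₃ ∧ √δ₃ < 0.586 ∧ 0.2649 < δ₃ ∧ δ₃ < 0.3432 := by
  obtain ⟨h1, h2⟩ := sqrt_two_bounds
  have h3 : 0.2649 < δ₃ ∧ δ₃ < 0.3432 := by
    rcases h with h | h <;> rw [h] <;> constructor <;> linarith
  refine ⟨?_, ?_, h3.1, h3.2⟩
  · rw [Real.lt_sqrt (by norm_num)]; norm_num; linarith
  · rw [Real.sqrt_lt' (by norm_num)]; norm_num; linarith

theorem singleBound_le {δ₁ δ₃ : ℝ} (h₁ : δ₁ = (4 + 8 * √2) / 7)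
    (h₃ : δ₃ = 6 - 4 * √2 ∨ δ₃ = 0.265) : singleBound δ₁ δ₃ 0.402 ≤ 3 + 2 * √2 := by
  obtain ⟨a1, a2⟩ := sqrt_two_bounds
  obtain ⟨b1, b2, _, _⟩ := sqrt_delta_one_bounds h₁
  obtain ⟨c1, c2, _, _⟩ := sqrt_delta_three_bounds h₃
  have hR : (1 + √δ₁) ^ 2 ≤ 6.146 := by nlinarith
  have hw : 0.171 ≤ (1 - √δ₃) ^ 2 := by nlinarith
  unfold singleBound
  rw [div_le_iff₀ (by nlinarith)]
  nlinarith

theorem mixBound_le {δ₁ : ℝ} (h₁ : δ₁ = (4 + 8 * √2) / 7) : mixBound δ₁ 0.402 ≤ 3 + 2 * √2 := by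
  obtain ⟨a1, a2⟩ := sqrt_two_bounds
  obtain ⟨_, _, b3, b4⟩ := sqrt_delta_one_bounds h₁
  have : √(2 * 0.402 ^ 2 + (1 - 0.402) * δ₁) ≤ 1.3 := by
    rw [Real.sqrt_le_left (by norm_num)]; norm_num; linarith
  unfold mixBound
  linarith

theorem oppositeBound_le {δ₁ δ₃ : ℝ} (h₁ : δ₁ = (4 + 8 * √2) / 7)
    (h₃ : δ₃ = 6 - 4 * √2 ∨ δ₃ = 0.265) : oppositeBound δ₁ δ₃ 0.402 ≤ 3 + 2 * √2 := by
  obtain ⟨a1, a2⟩ := sqrt_two_bounds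
  obtain ⟨b1, b2, b3, b4⟩ := sqrt_delta_one_bounds h₁
  obtain ⟨c1, c2, c3, c4⟩ := sqrt_delta_three_bounds h₃
  have hR : (1 + √δ₁) ^ 2 ≤ 6.146 := by nlinarith
  have hR' : 6.14 ≤ (1 + √δ₁) ^ 2 := by nlinarith
  have hK : (√δ₁ + √δ₃) ^ 2 ≤ 4.3 := by nlinarith
  have hK0 : 0 ≤ (√δ₁ + √δ₃) ^ 2 := sq_nonneg _
  have hRd : 6.14 * 0.2649 ≤ (1 + √δ₁) ^ 2 * δ₃ := by nlinarith
  unfold oppositeBound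
  generalize (1 + √δ₁) ^ 2 = R at *
  generalize (√δ₁ + √δ₃) ^ 2 = k at *
  rw [div_le_iff₀ (by nlinarith)]
  have e1 : R * (δ₁ + k) ≤ 6.146 * (δ₁ + k) := by
    apply mul_le_mul_of_nonneg_right hR; linarith
  have e2 : 5.828 * ((1 - 2 * 0.402) * (δ₁ + k) + 0.402 * R * δ₃) ≤
      (3 + 2 * √2) * ((1 - 2 * 0.402) * (δ₁ + k) + 0.402 * R * δ₃) := by
    apply mul_le_mul_of_nonneg_right <;> nlinarith
  nlinarith

/-- The lower bound for the slack of a client with at least two active neighbours. -/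
def pairSlack (M R q : ℝ) : ℝ :=
  min (M * (1 - q) - 1 / 2 - (R - 1 / 2) * (1 - q) ^ 2) (M * (1 - q) - 1 - (R - 1) * (1 - q) ^ 3)

/-- The room required by the averaging lemmas. It uses `5.828 < 3 + 2√2`, so `M - D ≥ 5.828 - 6.146
= -0.318`. In `r = 1 - q ∈ [0.196, 0.808]` the claims become polynomial inequalities of degree at
most three, obtained with the help of `(r - 0.196)(0.808 - r) ≥ 0`. -/
theorem pairSlack_bounds {M R q D : ℝ} (hM : 3 + 2 * √2 ≤ M) (hR : R ≤ 6.146) (hq0 : 0.192 ≤ q)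
    (hq1 : q ≤ 0.804) (hD : D ≤ R) :
    0 ≤ pairSlack M R q ∧ 0 ≤ pairSlack M R q + (1 - q) * (M - D) ∧
    0 ≤ pairSlack M R q + (2 - q) * (M - D) + (M - 1) * (q * (3 - 2 * √2)) ∧
    0 ≤ pairSlack M R q + (3 - 2 * q) * (M - D) + (M - 1) * q := by
  obtain ⟨a1, a2⟩ := sqrt_two_bounds
  obtain ⟨r, hr⟩ : ∃ r, r = 1 - q := ⟨_, rfl⟩
  have hr0 : 0.196 ≤ r := by linarith
  have hr1 : r ≤ 0.808 := by linarith
  have hlow : min (5.828 * r - 1 / 2 - 5.646 * r ^ 2) (5.828 * r - 1 - 5.146 * r ^ 3) ≤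
      pairSlack M R q := by
    have m1 : 5.828 * r ≤ M * r := by
      apply mul_le_mul_of_nonneg_right <;> linarith
    have m2 : (R - 1 / 2) * r ^ 2 ≤ 5.646 * r ^ 2 := by
      apply mul_le_mul_of_nonneg_right _ (sq_nonneg r); linarith
    have m3 : (R - 1) * r ^ 3 ≤ 5.146 * r ^ 3 := by
      apply mul_le_mul_of_nonneg_right _ (by positivity); linarith
    unfold pairSlack
    rw [← hr]
    exact min_le_min (by linarith) (by linarith)
  have d1 : ∀ c : ℝ, 0 ≤ c → c * (-0.318) ≤ c * (M - D) := fun c hc =>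
    mul_le_mul_of_nonneg_left (by linarith) hc
  have e1 := d1 (1 - q) (by linarith)
  have e2 := d1 (2 - q) (by linarith)
  have e3 := d1 (3 - 2 * q) (by linarith)
  have f2 : 4.828 * (q * 0.1715) ≤ (M - 1) * (q * (3 - 2 * √2)) := by
    apply mul_le_mul (by linarith) _ (by nlinarith) (by linarith)
    apply mul_le_mul_of_nonneg_left _ (by linarith); linarith
  have f3 : 4.828 * q ≤ (M - 1) * q := by
    apply mul_le_mul_of_nonneg_right <;> linarith
  have hq : q = 1 - r := by linarith
  have p1 : 0 ≤ (r - 0.196) * (0.808 - r) := mul_nonneg (by linarith) (by linarith)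
  have p2 : 0 ≤ (r - 0.196) * (0.808 - r) * r := mul_nonneg p1 (by linarith)
  have g : ∀ c, -c ≤ 5.828 * r - 1 / 2 - 5.646 * r ^ 2 → -c ≤ 5.828 * r - 1 - 5.146 * r ^ 3 →
      0 ≤ pairSlack M R q + c := fun c h1 h2 => by
    have := le_min h1 h2
    linarith
  refine ⟨?_, ?_, ?_, ?_⟩
  · have := g 0 (by nlinarith) (by nlinarith)
    linarith
  · have := g ((1 - q) * (-0.318)) (by rw [hq]; nlinarith) (by rw [hq]; nlinarith)
    linarith
  · have := g ((2 - q) * (-0.318) + 4.828 * (q * 0.1715)) (by rw [hq]; nlinarith)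
      (by rw [hq]; nlinarith)
    linarith
  · have := g ((3 - 2 * q) * (-0.318) + 4.828 * q) (by rw [hq]; nlinarith) (by rw [hq]; nlinarith)
    linarith

/-- Convexity of the root of a quadratic between `p` and `1`. The quadratic `2p² - δp + δ` has
discriminant `δ(δ - 8) ≤ 0`, so its homogenization is positive semidefinite, and `hcs` is the
Cauchy–Schwarz inequality of that form at `p` and `1`. -/
theorem sqrt_quadratic_le {δ p l : ℝ} (hδ0 : 0 ≤ δ) (hδ : δ ≤ 8) (hl0 : 0 ≤ l) (hl1 : l ≤ 1)
    (hp : p ≤ 1) :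
    √(2 * (l * p + (1 - l)) ^ 2 + (1 - (l * p + (1 - l))) * δ) ≤
      l * √(2 * p ^ 2 + (1 - p) * δ) + (1 - l) * √2 := by
  have hQ0 : 0 ≤ 2 * p ^ 2 + (1 - p) * δ :=
    add_nonneg (by positivity) (mul_nonneg (by linarith) hδ0)
  have hcs : 2 * p + δ * (1 - p) / 2 ≤ √(2 * p ^ 2 + (1 - p) * δ) * √2 := by
    rw [← Real.sqrt_mul hQ0]
    apply Real.le_sqrt_of_sq_le
    have : 0 ≤ (1 - p) ^ 2 * (δ * (8 - δ)) :=
      mul_nonneg (sq_nonneg _) (mul_nonneg hδ0 (by linarith))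
    nlinarith
  rw [Real.sqrt_le_left (by
    have := Real.sqrt_nonneg (2 * p ^ 2 + (1 - p) * δ)
    have := Real.sqrt_nonneg 2
    have := sub_nonneg.mpr hl1
    positivity)]
  have s1 := Real.sq_sqrt hQ0
  have s2 : √2 ^ 2 = 2 := Real.sq_sqrt (by norm_num)
  have hm := mul_le_mul_of_nonneg_left hcs (mul_nonneg hl0 (sub_nonneg.mpr hl1))
  have e : (l * √(2 * p ^ 2 + (1 - p) * δ) + (1 - l) * √2) ^ 2 =
      l ^ 2 * √(2 * p ^ 2 + (1 - p) * δ) ^ 2 + (1 - l) ^ 2 * √2 ^ 2 +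
      2 * (l * (1 - l) * (√(2 * p ^ 2 + (1 - p) * δ) * √2)) := by ring
  rw [e, s1, s2]
  nlinarith

/-- By convexity, `mixBound` on `[p, 1]` is at most its maximum over the two endpoints. -/
theorem mixBound_le_max {δ p θ : ℝ} (hδ0 : 0 ≤ δ) (hδ : δ ≤ 8) (hp : p < 1) (h1 : p ≤ θ)
    (h2 : θ ≤ 1) : mixBound δ θ ≤ max (3 + 2 * √2) (mixBound δ p) := by
  obtain ⟨l, hl⟩ : ∃ l, l = (1 - θ) / (1 - p) := ⟨_, rfl⟩
  have hp' : 0 < 1 - p := by linarith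
  have hl0 : 0 ≤ l := by rw [hl]; exact div_nonneg (by linarith) hp'.le
  have hl1 : l ≤ 1 := by rw [hl, div_le_one hp']; linarith
  have hθ : θ = l * p + (1 - l) := by rw [hl]; field_simp; ring
  have hs := sqrt_quadratic_le hδ0 hδ hl0 hl1 hp.le
  rw [← hθ] at hs
  have m1 := mul_le_mul_of_nonneg_left (le_max_right (3 + 2 * √2) (mixBound δ p)) hl0
  have m2 := mul_le_mul_of_nonneg_left (le_max_left (3 + 2 * √2) (mixBound δ p))
    (sub_nonneg.mpr hl1)
  -- The endpoint `θ = 1` contributes `mixBound δ 1 = 3 + 2√2`.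
  have : mixBound δ θ ≤ l * mixBound δ p + (1 - l) * (3 + 2 * √2) := by
    unfold mixBound
    nlinarith
  linarith

/-- Here `a` is the normalized distance to the single neighbour. The two bounds on `D` coincide at
`a = 1 - √δ₃`, the worst case, where the claim is the definition of `singleBound`. For larger `a`
the payment term grows; for smaller `a` the second bound on `D` falls fast enough, which after
cancelling `1 - √δ₃ - a` is `hbr`. -/
theorem singleBound_mul_ge {δ₁ δ₃ p a D : ℝ} (hs0 : 1.479 ≤ √δ₁) (hs : √δ₁ ≤ 1.4791)
    (hu0 : 0.51 ≤ √δ₃) (hu1 : √δ₃ ≤ 1) (hp0 : 0 ≤ p) (hp1 : p ≤ 0.402) (ha : 0 ≤ a)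
    (hD : D ≤ (1 + √δ₁) ^ 2) (hD' : D ≤ (a + √δ₃ + √δ₁) ^ 2) :
    (1 - p) * D + p * a ^ 2 ≤ singleBound δ₁ δ₃ p * (1 - p + p * a ^ 2) := by
  obtain ⟨B, hB⟩ : ∃ B, B = singleBound δ₁ δ₃ p := ⟨_, rfl⟩
  rw [← hB]
  have hden : 0 < 1 - p + p * (1 - √δ₃) ^ 2 := by
    have := mul_nonneg hp0 (sq_nonneg (1 - √δ₃))
    linarith
  have hBeq : B * (1 - p + p * (1 - √δ₃) ^ 2) =
      (1 - p) * (1 + √δ₁) ^ 2 + p * (1 - √δ₃) ^ 2 := by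
    rw [hB]; unfold singleBound; exact div_mul_cancel₀ _ hden.ne'
  have hR1 : 1 ≤ (1 + √δ₁) ^ 2 := by nlinarith
  have hR2 : (1 + √δ₁) ^ 2 ≤ 6.146 := by nlinarith
  have hz := mul_nonneg hp0 (sq_nonneg (1 - √δ₃))
  have hB1 : 1 ≤ B := by
    rw [hB]; unfold singleBound; rw [le_div_iff₀ hden]; nlinarith
  have hB2 : B ≤ 6.146 := by
    rw [hB]; unfold singleBound; rw [div_le_iff₀ hden]; nlinarith
  have hp' : 0 ≤ 1 - p := by linarith
  rcases le_total (1 - √δ₃) a with h | h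
  · have h2 : (1 - √δ₃) ^ 2 ≤ a ^ 2 := by
      apply pow_le_pow_left₀ (by linarith) h
    have m1 := mul_le_mul_of_nonneg_left hD hp'
    have m2 := mul_le_mul_of_nonneg_left h2 (mul_nonneg (sub_nonneg.mpr hB1) hp0)
    nlinarith
  · have m1 := mul_le_mul_of_nonneg_left hD' hp'
    have hbr : 0 ≤ (1 - p) * (a + (1 - √δ₃) + 2 * (√δ₃ + √δ₁)) -
        p * (B - 1) * (a + (1 - √δ₃)) := by
      have e1 : p * (B - 1) ≤ 0.402 * 5.146 :=
        mul_le_mul hp1 (by linarith) (by linarith) (by norm_num)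
      have e2 : p * (B - 1) * (a + (1 - √δ₃)) ≤ 0.402 * 5.146 * (2 * 0.49) :=
        mul_le_mul e1 (by linarith) (by linarith) (by norm_num)
      have e3 : 0.598 * (2 * 1.9) ≤ (1 - p) * (a + (1 - √δ₃) + 2 * (√δ₃ + √δ₁)) := by
        apply mul_le_mul (by linarith) (by linarith) (by norm_num) hp'
      linarith
    have m2 := mul_nonneg (sub_nonneg.mpr h) hbr
    nlinarith

/-- Here `a` and `b` are the normalized distances to the two neighbours, and `τ` is the root of the
smaller normalized `t`-value. Eliminating `τ` bounds `√δ₃ · √D` linearly in `a` and `b`, and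
Cauchy–Schwarz turns this into `δ₃ D ≤ K(a² + b²)`. -/
theorem oppositeBound_mul_ge {δ₁ δ₃ p a b τ D : ℝ} (hδ₁ : 0 < δ₁) (hδ₃ : 0 ≤ δ₃)
    (hp0 : 0 ≤ p) (hp1 : p < 1 / 2) (hD0 : 0 ≤ D) (hD : D ≤ (1 + √δ₁) ^ 2) (hab : √δ₃ * τ ≤ a + b)
    (hDa : √D ≤ a + √δ₁ * τ) {M : ℝ} (hM : oppositeBound δ₁ δ₃ p ≤ M) (hM1 : 1 ≤ M) :
    0 ≤ (1 - 2 * p) * (M - D) + (M - 1) * (p * (a ^ 2 + b ^ 2)) := by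
  obtain ⟨K, hK⟩ : ∃ K, K = δ₁ + (√δ₁ + √δ₃) ^ 2 := ⟨_, rfl⟩
  have hs := Real.sqrt_nonneg δ₁
  have hu := Real.sqrt_nonneg δ₃
  have hs2 := Real.sq_sqrt hδ₁.le
  have hu2 := Real.sq_sqrt hδ₃
  have hd2 := Real.sq_sqrt hD0
  have hKpos : 0 < K := by rw [hK]; positivity
  have hp' : 0 < 1 - 2 * p := by linarith
  have hlin : √δ₃ * √D ≤ (√δ₁ + √δ₃) * a + √δ₁ * b := by
    have h1 := mul_le_mul_of_nonneg_left hDa hu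
    have h2 := mul_le_mul_of_nonneg_left hab hs
    linarith
  have hcs : δ₃ * D ≤ K * (a ^ 2 + b ^ 2) := by
    have h1 : (√δ₃ * √D) ^ 2 ≤ ((√δ₁ + √δ₃) * a + √δ₁ * b) ^ 2 :=
      pow_le_pow_left₀ (by positivity) hlin 2
    rw [mul_pow, hu2, hd2] at h1
    have h2 : 0 ≤ ((√δ₁ + √δ₃) * b - √δ₁ * a) ^ 2 := sq_nonneg _
    rw [hK]
    nlinarith
  have hM' : (1 - 2 * p) * (1 + √δ₁) ^ 2 * K + p * (1 + √δ₁) ^ 2 * δ₃ ≤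
      M * ((1 - 2 * p) * K + p * (1 + √δ₁) ^ 2 * δ₃) := by
    unfold oppositeBound at hM
    rw [← hK] at hM
    rwa [div_le_iff₀ (by positivity)] at hM
  obtain ⟨R, hR⟩ : ∃ R, R = (1 + √δ₁) ^ 2 := ⟨_, rfl⟩
  rw [← hR] at hM' hD
  have hRpos : 0 < R := by rw [hR]; positivity
  have m1 := mul_le_mul_of_nonneg_left hcs (mul_nonneg (sub_nonneg.mpr hM1) hp0)
  -- The expression is affine in `D`: nonnegative at `D = 0`, and at `D = R` by the choice of `M`.
  have hfin : 0 ≤ K * ((1 - 2 * p) * (M - D)) + (M - 1) * p * (δ₃ * D) := by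
    have h1 : 0 ≤ K * ((1 - 2 * p) * (M - R)) + (M - 1) * p * (δ₃ * R) := by nlinarith
    have h2 : 0 ≤ K * ((1 - 2 * p) * M) := by positivity
    have h3 := mul_nonneg h1 hD0
    have h4 := mul_nonneg h2 (sub_nonneg.mpr hD)
    have : R * (K * ((1 - 2 * p) * (M - D)) + (M - 1) * p * (δ₃ * D)) =
      (K * ((1 - 2 * p) * (M - R)) + (M - 1) * p * (δ₃ * R)) * D +
        K * ((1 - 2 * p) * M) * (R - D) := by ring
    by_contra hneg
    push Not at hneg
    have := mul_neg_of_pos_of_neg hRpos hneg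
    linarith
  have : 0 ≤ K * ((1 - 2 * p) * (M - D) + (M - 1) * (p * (a ^ 2 + b ^ 2))) := by linarith
  exact nonneg_of_mul_nonneg_right this hKpos

end Numerics

/-! ### Maximal independent sets and nested quasi-independent sets -/

section Nested

theorem IsMaxIndepIn.subset {F : Type*} {G : SimpleGraph F} {V I : Finset F}
    (h : IsMaxIndepIn G V I) : I ⊆ V := h.prop.1

theorem IsMaxIndepIn.not_adj {F : Type*} {G : SimpleGraph F} {V I : Finset F}
    (h : IsMaxIndepIn G V I) {i k : F} (hi : i ∈ I) (hk : k ∈ I) : ¬ G.Adj i k := by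
  intro hadj
  exact h.prop.2 hi hk hadj.ne hadj

theorem IsMaxIndepIn.exists_adj {F : Type*} [DecidableEq F] {G : SimpleGraph F} {V I : Finset F}
    (h : IsMaxIndepIn G V I) {v : F} (hv : v ∈ V) (hvI : v ∉ I) : ∃ i ∈ I, G.Adj v i := by
  by_contra hcon
  push Not at hcon
  have hins : insert v I ⊆ V ∧ G.IsIndepSet ((insert v I : Finset F) : Set F) := by
    refine ⟨Finset.insert_subset hv h.subset, ?_⟩
    intro a ha b hb hab
    rw [Finset.mem_coe, Finset.mem_insert] at ha hb
    rcases ha with rfl | ha <;> rcases hb with rfl | hb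
    · exact absurd rfl hab
    · exact hcon b hb
    · exact fun hadj => hcon a ha hadj.symm
    · exact h.not_adj ha hb
  exact hvI (h.le_of_ge hins (Finset.subset_insert v I) (Finset.mem_insert_self v I))

theorem exists_isMaxIndepIn {F : Type*} (G : SimpleGraph F) (V : Finset F) :
    ∃ I, IsMaxIndepIn G V I := by
  have hfin : {J : Finset F | J ⊆ V ∧ G.IsIndepSet (J : Set F)}.Finite :=
    V.powerset.finite_toSet.subset fun J hJ => by simpa using hJ.1
  obtain ⟨I, hI⟩ := hfin.exists_maximal ⟨∅, by simp [SimpleGraph.IsIndepSet]⟩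
  exact ⟨I, hI⟩

variable {d : ℕ} {F : Type*} {fac : F → EuclideanSpace ℝ (Fin d)} {t : F → ℝ}
  {δ₁ δ₂ δ₃ : ℝ} {V I₁ I₂ I₃ : Finset F}

theorem lt_cost_of_not_adj {δ : ℝ} {i k : F} (hne : i ≠ k)
    (h : ¬ (conflictGraph fac t δ).Adj i k) : δ * min (t i) (t k) < cost (fac i) (fac k) := by
  by_contra hcon
  exact h ⟨hne, not_lt.mp hcon⟩

open scoped Classical in
/-- The element of `I` whose fair coin controls `i`: its neighbour in `I` if there is one, and `i`
otherwise. -/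
def coinOf (G : SimpleGraph F) (I : Finset F) (i : F) : F :=
  if h : ∃ q ∈ I, G.Adj i q then h.choose else i

theorem coinOf_spec {G : SimpleGraph F} {I : Finset F} {i : F} (h : ∃ q ∈ I, G.Adj i q) :
    coinOf G I i ∈ I ∧ G.Adj i (coinOf G I i) := by
  unfold coinOf
  rw [dif_pos h]
  exact h.choose_spec

variable [DecidableEq F]

namespace IsNestedQuasiIndep

theorem mem_two (h : IsNestedQuasiIndep fac t δ₁ δ₂ δ₃ V I₁ I₂ I₃) {i : F} (hi : i ∈ I₂) :
    i ∈ V ∧ i ∉ I₁ ∧ ∀ k ∈ I₁, ¬ (conflictGraph fac t δ₂).Adj i k := by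
  have := h.second.subset hi
  simpa [levelTwo, and_assoc] using this

theorem mem_three (h : IsNestedQuasiIndep fac t δ₁ δ₂ δ₃ V I₁ I₂ I₃) {i : F} (hi : i ∈ I₃) :
    i ∈ V ∧ i ∉ I₁ ∧ i ∉ I₂ ∧ (∀ k ∈ I₁, ¬ (conflictGraph fac t δ₂).Adj i k) ∧
      (∃! k, k ∈ I₂ ∧ (conflictGraph fac t δ₂).Adj i k) ∧
      ∀ k ∈ I₂, ¬ (conflictGraph fac t δ₃).Adj i k := by
  have := h.third.subset hi
  simp only [levelThree, levelTwo, Finset.mem_filter, Finset.mem_sdiff] at this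
  obtain ⟨⟨⟨⟨h1, h2⟩, _⟩, h3⟩, h4, h5, h6⟩ := this
  exact ⟨h1, h2, h3, h5, h4, h6⟩

theorem coinOf_two (h : IsNestedQuasiIndep fac t δ₁ δ₂ δ₃ V I₁ I₂ I₃) {i : F} (hi : i ∈ I₂) :
    coinOf (conflictGraph fac t δ₂) I₂ i = i := by
  unfold coinOf
  rw [dif_neg]
  rintro ⟨k, hk, hadj⟩
  exact h.second.not_adj hi hk hadj

theorem coinOf_three (h : IsNestedQuasiIndep fac t δ₁ δ₂ δ₃ V I₁ I₂ I₃) {i k : F} (hi : i ∈ I₃)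
    (hk : k ∈ I₂) :
    coinOf (conflictGraph fac t δ₂) I₂ i = k ↔ (conflictGraph fac t δ₂).Adj i k := by
  have hu := (h.mem_three hi).2.2.2.2.1
  have hs := coinOf_spec hu.exists
  constructor
  · rintro rfl; exact hs.2
  · intro hadj
    exact hu.unique hs ⟨hk, hadj⟩

/-- A common form for both levels: a point of `I₂` is its own coin and needs heads, a point of `I₃`
has the coin of its unique neighbour and needs tails. -/
theorem centers_eq (h : IsNestedQuasiIndep fac t δ₁ δ₂ δ₃ V I₁ I₂ I₃) (ω σ : F → Bool) :
    centers fac t δ₂ I₁ I₂ I₃ (ω, σ) = I₁ ∪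
      {i ∈ active (coinOf (conflictGraph fac t δ₂) I₂) (fun i => decide (i ∈ I₂)) (I₂ ∪ I₃) ω |
        σ i = true} := by
  ext i
  simp only [centers, Finset.mem_union, Finset.mem_filter, mem_active, or_assoc]
  refine or_congr_right ?_
  by_cases h2 : i ∈ I₂
  · have h3 : i ∉ I₃ := fun h3 => (h.mem_three h3).2.2.1 h2
    simp [h2, h3, h.coinOf_two h2]
  · by_cases h3 : i ∈ I₃
    · have hs := coinOf_spec (h.mem_three h3).2.2.2.2.1.exists
      simp only [h2, h3, false_and, true_and, false_or, decide_false]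
      constructor
      · rintro ⟨hσ, k, hk, hadj, hω⟩
        rw [(h.coinOf_three h3 hk).mpr hadj]
        exact ⟨by simpa using hω, hσ⟩
      · rintro ⟨hω, hσ⟩
        exact ⟨hσ, _, hs.1, hs.2, hω⟩
    · simp [h2, h3]

theorem centers_subset (h : IsNestedQuasiIndep fac t δ₁ δ₂ δ₃ V I₁ I₂ I₃) (ω : Coins F) :
    centers fac t δ₂ I₁ I₂ I₃ ω ⊆ V := by
  intro i hi
  simp only [centers, Finset.mem_union, Finset.mem_filter] at hi
  rcases hi with (hi | hi) | hi
  · exact h.first.subset hi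
  · exact (h.mem_two hi.1).1
  · exact (h.mem_three hi.1).1

/-- Two chosen points conflict in `H(δ₂)` only if one of them controls the other. -/
theorem not_adj (h : IsNestedQuasiIndep fac t δ₁ δ₂ δ₃ V I₁ I₂ I₃) (ht : ∀ i ∈ V, 0 ≤ t i)
    (hδ : δ₂ ≤ δ₁) {i k : F} (hi : i ∈ I₁ ∪ (I₂ ∪ I₃)) (hk : k ∈ I₁ ∪ (I₂ ∪ I₃))
    (h1 : i ∈ I₂ → k ∈ I₃ → coinOf (conflictGraph fac t δ₂) I₂ k ≠ i)
    (h2 : k ∈ I₂ → i ∈ I₃ → coinOf (conflictGraph fac t δ₂) I₂ i ≠ k) :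
    ¬ (conflictGraph fac t δ₂).Adj i k := by
  simp only [Finset.mem_union] at hi hk
  rcases hi with hi | hi | hi <;> rcases hk with hk | hk | hk
  · intro hadj
    refine h.first.not_adj hi hk ⟨hadj.1, hadj.2.trans ?_⟩
    exact mul_le_mul_of_nonneg_right hδ
      (le_min (ht i (h.first.subset hi)) (ht k (h.first.subset hk)))
  · exact fun hadj => (h.mem_two hk).2.2 i hi hadj.symm
  · exact fun hadj => (h.mem_three hk).2.2.2.1 i hi hadj.symm
  · exact (h.mem_two hi).2.2 k hk
  · exact h.second.not_adj hi hk
  · exact fun hadj => h1 hi hk ((h.coinOf_three hk hi).mpr hadj.symm)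
  · exact (h.mem_three hi).2.2.2.1 k hk
  · exact fun hadj => h2 hk hi ((h.coinOf_three hi hk).mpr hadj)
  · exact h.third.not_adj hi hk

theorem disjoint_one (h : IsNestedQuasiIndep fac t δ₁ δ₂ δ₃ V I₁ I₂ I₃) :
    Disjoint I₁ (I₂ ∪ I₃) := by
  rw [Finset.disjoint_left]
  intro i hi hk
  rcases Finset.mem_union.mp hk with hk | hk
  · exact (h.mem_two hk).2.1 hi
  · exact (h.mem_three hk).2.1 hi

/-- Two points of `I₁` or active points are not adjacent in `H(δ₂)`. -/
theorem not_adj_of_active (h : IsNestedQuasiIndep fac t δ₁ δ₂ δ₃ V I₁ I₂ I₃)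
    (ht : ∀ i ∈ V, 0 ≤ t i) (hδ : δ₂ ≤ δ₁) (ω : F → Bool) {i k : F}
    (hi : i ∈ I₁ ∪ active (coinOf (conflictGraph fac t δ₂) I₂) (fun i => decide (i ∈ I₂))
      (I₂ ∪ I₃) ω)
    (hk : k ∈ I₁ ∪ active (coinOf (conflictGraph fac t δ₂) I₂) (fun i => decide (i ∈ I₂))
      (I₂ ∪ I₃) ω) : ¬ (conflictGraph fac t δ₂).Adj i k := by
  have hsub : I₁ ∪ active (coinOf (conflictGraph fac t δ₂) I₂) (fun i => decide (i ∈ I₂))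
      (I₂ ∪ I₃) ω ⊆ I₁ ∪ (I₂ ∪ I₃) :=
    Finset.union_subset_union_right (Finset.filter_subset _ _)
  have key : ∀ a b, a ∈ I₁ ∪ active (coinOf (conflictGraph fac t δ₂) I₂)
      (fun i => decide (i ∈ I₂)) (I₂ ∪ I₃) ω →
      b ∈ I₁ ∪ active (coinOf (conflictGraph fac t δ₂) I₂) (fun i => decide (i ∈ I₂))
      (I₂ ∪ I₃) ω → a ∈ I₂ → b ∈ I₃ → coinOf (conflictGraph fac t δ₂) I₂ b ≠ a := by
    intro a b ha hb ha2 hb3 hab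
    have ha' := (Finset.mem_union.mp ha).resolve_left (h.mem_two ha2).2.1
    have hb' := (Finset.mem_union.mp hb).resolve_left (h.mem_three hb3).2.1
    rw [mem_active] at ha' hb'
    have e1 := ha'.2
    have e2 := hb'.2
    rw [h.coinOf_two ha2] at e1
    rw [hab, e1] at e2
    simp [ha2, (h.mem_three hb3).2.2.1] at e2
  exact h.not_adj ht hδ (hsub hi) (hsub hk) (key i k hi hk) (key k i hk hi)

end IsNestedQuasiIndep

end Nested

/-! ### Bounds for fixed fair coins -/

section FixedCoins

variable {d : ℕ} {F : Type*} [DecidableEq F] (fac : F → EuclideanSpace ℝ (Fin d))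
  (z : EuclideanSpace ℝ (Fin d))

/-- The variance inequality with unit weights. It says that points at pairwise cost at least `2α`
receive from `z` a total `∑ (α - c)` of at most `α`. -/
theorem card_sub_one_mul_le_sum {B : Finset F} (hB : B.Nonempty) {α : ℝ}
    (hpair : ∀ i ∈ B, ∀ k ∈ B, i ≠ k → 2 * α ≤ cost (fac i) (fac k)) :
    α * (B.card - 1) ≤ ∑ i ∈ B, cost z (fac i) := by
  have h := weighted_sum_cost_ge fac z (A := ∅) (B := B) (Finset.disjoint_empty_left _) (α := α)
    (δ := 0) (u := 0) (q := 1) le_rfl zero_le_one (by simpa using hpair) (by simp)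
  have hpos : (0 : ℝ) < B.card := by exact_mod_cast hB.card_pos
  simp only [Finset.card_empty, Nat.cast_zero, Finset.sum_empty] at h
  have : (B.card : ℝ) * (α * (B.card - 1)) ≤ B.card * ∑ i ∈ B, cost z (fac i) := by linarith
  exact le_of_mul_le_mul_left this hpos

variable [Fintype F]

/-- The guarantee of a client with a neighbour in `I`, for fixed fair coins. -/
theorem biasedExpect_costTo_le_of_inter_nonempty {I A N : Finset F} (hIA : Disjoint I A)
    (hNI : (N ∩ I).Nonempty) {α δ q ρ : ℝ} (hα : 0 ≤ α) (hδ : δ = (4 + 8 * √2) / 7) (hq0 : 0 ≤ q)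
    (hq1 : q ≤ 1) (hρ : 3 + 2 * √2 ≤ ρ) (hρq : 1 ≤ ρ * (1 - q))
    (hpair : ∀ i ∈ N ∩ (I ∪ A), ∀ k ∈ N ∩ (I ∪ A), i ≠ k → 2 * α ≤ cost (fac i) (fac k))
    (hI : ∀ i ∈ N ∩ I, ∀ k ∈ N ∩ I, i ≠ k → δ * α ≤ cost (fac i) (fac k)) :
    biasedExpect q (fun σ => costTo fac z (I ∪ {i ∈ A | σ i = true})) ≤
      ρ * (α - ∑ i ∈ N ∩ I, (α - cost z (fac i)) - q * ∑ i ∈ N ∩ A, (α - cost z (fac i))) := by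
  obtain ⟨a1, a2⟩ := sqrt_two_bounds
  have hs2 : √2 ^ 2 = 2 := Real.sq_sqrt (by norm_num)
  have hρpos : 0 < ρ := by linarith
  obtain ⟨X, hX⟩ : ∃ X, X = ∑ i ∈ N ∩ I, cost z (fac i) := ⟨_, rfl⟩
  obtain ⟨Y, hY⟩ : ∃ Y, Y = ∑ i ∈ N ∩ A, cost z (fac i) := ⟨_, rfl⟩
  obtain ⟨a, ha⟩ : ∃ a : ℝ, a = (N ∩ I).card := ⟨_, rfl⟩
  obtain ⟨b, hb⟩ : ∃ b : ℝ, b = (N ∩ A).card := ⟨_, rfl⟩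
  have ha1 : 1 ≤ a := by
    rw [ha]; exact_mod_cast hNI.card_pos
  have ha12 : a = 1 ∨ 2 ≤ a := by
    rw [ha]
    rcases Nat.lt_or_eq_of_le (Nat.succ_le_of_lt hNI.card_pos) with h | h
    · right; exact_mod_cast h
    · left; exact_mod_cast h.symm
  have hb0 : 0 ≤ b := by rw [hb]; positivity
  -- All `a` points of `N ∩ I` are open, so the cost is at most their average cost.
  have hNum : biasedExpect q (fun σ => costTo fac z (I ∪ {i ∈ A | σ i = true})) ≤ X / a := by
    refine biasedExpect_le_of_forall_le hq0 hq1 fun σ => ?_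
    rw [le_div_iff₀ (by linarith), mul_comm, ha, hX, ← nsmul_eq_mul, ← Finset.sum_const]
    refine Finset.sum_le_sum fun i hi => costTo_le fac z ?_
    exact Finset.mem_union_left _ (Finset.mem_inter.mp hi).2
  obtain ⟨v, hv⟩ : ∃ v, v = ρ⁻¹ := ⟨_, rfl⟩
  have hvρ : ρ * v = 1 := by rw [hv]; exact mul_inv_cancel₀ hρpos.ne'
  have hv0 : 0 < v := by rw [hv]; positivity
  have hvq : v ≤ 1 - q := by
    have := mul_le_mul_of_nonneg_left hρq hv0.le
    nlinarith
  have hv1 : v < 1 := by nlinarith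
  -- With this weight `ρ·u·X = ρ·X - X/a`, so the average cost is absorbed and the claim reduces to
  -- `hfin`, the variance inequality with weights `u` and `q`.
  obtain ⟨u, hu⟩ : ∃ u, u = (a - v) / a := ⟨_, rfl⟩
  have hua : u * a = a - v := by rw [hu]; field_simp
  have hu0 : 0 < u := by rw [hu]; apply div_pos <;> linarith
  have hw := weighted_sum_cost_ge fac z (A := N ∩ I) (B := N ∩ A)
    (Finset.disjoint_of_subset_left Finset.inter_subset_right
      (Finset.disjoint_of_subset_right Finset.inter_subset_right hIA)) hu0.le hq0
    (by rwa [← Finset.inter_union_distrib_left]) hI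
  rw [← hX, ← hY, ← ha, ← hb] at hw
  -- The origin of `δ₁`: `δ/2 - 1 = (4√2 - 5)/7`, and `(4√2 - 5)(4√2 + 5) = 7`, so equality holds at
  -- `ρ = 3 + 2√2`.
  have hη : 1 ≤ (δ / 2 - 1) * (2 * ρ - 1) := by
    have h1 : 0 ≤ δ / 2 - 1 := by rw [hδ]; linarith
    have h2 := mul_le_mul_of_nonneg_left (show 5 + 4 * √2 ≤ 2 * ρ - 1 by linarith) h1
    have h3 : (δ / 2 - 1) * (5 + 4 * √2) = 1 := by rw [hδ]; nlinarith
    linarith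
  have hηv : 2 ≤ a → v ≤ (δ / 2 - 1) * (a - v) := by
    intro h2
    have h1 : 0 ≤ δ / 2 - 1 := by rw [hδ]; linarith
    have h3 := mul_le_mul_of_nonneg_left hη hv0.le
    have h4 : v * ((δ / 2 - 1) * (2 * ρ - 1)) = (δ / 2 - 1) * (2 - v) := by
      linear_combination 2 * (δ / 2 - 1) * hvρ
    have h5 := mul_le_mul_of_nonneg_left (show 2 - v ≤ a - v by linarith) h1
    linarith
  have hW : 0 < u * a + q * b := by
    have := mul_nonneg hq0 hb0
    have : 0 < u * a := by rw [hua]; linarith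
    linarith
  have hcore : 0 ≤ (u * a + q * b) * (1 - a - q * b) + ((u * a + q * b) ^ 2 -
      (u ^ 2 * a + q ^ 2 * b) + (δ / 2 - 1) * u ^ 2 * (a * (a - 1))) := by
    have e : (u * a + q * b) * (1 - a - q * b) + ((u * a + q * b) ^ 2 -
      (u ^ 2 * a + q ^ 2 * b) + (δ / 2 - 1) * u ^ 2 * (a * (a - 1))) =
      q * b * (1 - v - q) + u * ((a - 1) * ((δ / 2 - 1) * (a - v) - v)) := by
      have e1 : u ^ 2 * a = u * (a - v) := by rw [← hua]; ring
      have e2 : (δ / 2 - 1) * u ^ 2 * (a * (a - 1)) = (δ / 2 - 1) * (u * (a - v)) * (a - 1) := by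
        rw [← e1]; ring
      rw [e2, e1]
      linear_combination (u * a + q * b) * hua
    rw [e]
    refine add_nonneg (mul_nonneg (mul_nonneg hq0 hb0) (by linarith)) (mul_nonneg hu0.le ?_)
    rcases ha12 with h | h
    · rw [h]; simp
    · exact mul_nonneg (by linarith) (by linarith [hηv h])
  have hfin : 0 ≤ α * (1 - a - q * b) + (u * X + q * Y) := by
    have h1 := mul_nonneg hα hcore
    have h2 : 0 ≤ (u * a + q * b) * (α * (1 - a - q * b) + (u * X + q * Y)) := by linarith
    exact nonneg_of_mul_nonneg_right h2 hW
  refine hNum.trans ?_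
  rw [Finset.sum_sub_distrib, Finset.sum_sub_distrib, Finset.sum_const, Finset.sum_const,
    nsmul_eq_mul, nsmul_eq_mul, ← hX, ← hY, ← ha, ← hb]
  have h3 := mul_nonneg hρpos.le hfin
  have h4 : ρ * (u * X) = ρ * X - X / a := by
    rw [hu]
    field_simp
    linear_combination (-X) * hvρ
  linarith

end FixedCoins

/-! ### Slack bounds for a client without a neighbour in `I₁` -/

section Slack

variable {d : ℕ} {F : Type*} [DecidableEq F] [Fintype F] (fac : F → EuclideanSpace ℝ (Fin d))
  (z : EuclideanSpace ℝ (Fin d))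

/-- The slack bounds for a client `z` with value `α` and neighbourhood `N`, when all points of `I` are
centers. -/
theorem slackBounds {α : ℝ} (hα : 0 < α) {I P N : Finset F} {κ : F → F} {π : F → Bool}
    (hI : I.Nonempty) (hNP : N ⊆ P) (hc : ∀ i ∈ N, cost z (fac i) < α)
    (hpair : ∀ ω, ∀ i ∈ active κ π N ω, ∀ k ∈ active κ π N ω, i ≠ k →
      2 * α ≤ cost (fac i) (fac k))
    {M R q : ℝ} (hM : 1 ≤ M) (hq0 : 0 ≤ q) (hq1 : q ≤ 1) (hR : costTo fac z I ≤ R * α)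
    (hΦ : 0 ≤ pairSlack M R q) :
    SlackBounds κ π P N (fun i => cost z (fac i) / α) M (costTo fac z I / α) q (pairSlack M R q)
      (fun ω => M * (1 - q * ∑ i ∈ active κ π N ω, (1 - cost z (fac i) / α)) -
        biasedExpect q (fun σ => costTo fac z (I ∪ {i ∈ active κ π P ω | σ i = true})) / α) := by
  have hD : ∀ (ω σ : F → Bool), costTo fac z (I ∪ {i ∈ active κ π P ω | σ i = true}) ≤
      costTo fac z I := fun ω σ => costTo_anti fac z hI Finset.subset_union_left
  have he : ∀ (ω : F → Bool) (i : F), i ∈ active κ π P ω → ∀ σ : F → Bool, σ i = true →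
      costTo fac z (I ∪ {i ∈ active κ π P ω | σ i = true}) ≤ cost z (fac i) :=
    fun ω i hi σ hσ => costTo_le fac z (Finset.mem_union_right _ (Finset.mem_filter.mpr ⟨hi, hσ⟩))
  have hsub : ∀ ω : F → Bool, active κ π N ω ⊆ active κ π P ω :=
    fun ω => Finset.filter_subset_filter _ hNP
  have hr := sub_nonneg.mpr hq1
  have hRD : costTo fac z I / α ≤ R := (div_le_iff₀ hα).mpr hR
  refine ⟨hM, hq0, hq1, fun i => div_nonneg (cost_nonneg _ _) hα.le, ?_, ?_, ?_, ?_, ?_, hΦ⟩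
  · intro ω h
    have := div_le_div_of_nonneg_right (biasedExpect_le_of_forall_le hq0 hq1 (hD ω)) hα.le
    simp only [h, Finset.sum_empty]
    linarith
  · intro ω h i hi
    have := div_le_div_of_nonneg_right (biasedExpect_le_one hq0 hq1 (hD ω) (he ω i hi)) hα.le
    simp only [h, Finset.sum_empty]
    rw [add_div, mul_div_assoc, mul_div_assoc] at this
    linarith
  · intro ω i h
    have hi : i ∈ active κ π N ω := by simp [h]
    have := div_le_div_of_nonneg_right
      (biasedExpect_le_one hq0 hq1 (hD ω) (he ω i (hsub ω hi))) hα.le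
    simp only [h, Finset.sum_singleton]
    rw [add_div, mul_div_assoc, mul_div_assoc] at this
    linarith
  · intro ω i h k hk hki
    have hi : i ∈ active κ π N ω := by simp [h]
    have := div_le_div_of_nonneg_right
      (biasedExpect_le_two hq0 hq1 hki.symm (hD ω) (he ω i (hsub ω hi)) (he ω k hk)) hα.le
    simp only [h, Finset.sum_singleton]
    rw [add_div, mul_div_assoc, mul_div_assoc, add_div, mul_div_assoc, mul_div_assoc] at this
    linarith
  · intro ω h
    -- With three or more active neighbours, any of three successes gives cost at most `α`. With
    -- exactly two, the bounds for the two orders of consulting the coins are averaged, which leaves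
    -- only the sum `s ≥ 1` of the normalized costs; the slack bound increases with `s`.
    rcases Nat.lt_or_eq_of_le (Nat.succ_le_of_lt h) with h3 | h2
    · refine (min_le_right _ _).trans ?_
      obtain ⟨i, k, l, hi, hk, hl, hik, hil, hkl⟩ := Finset.two_lt_card_iff.mp h3
      have hlow := card_sub_one_mul_le_sum fac z ⟨i, hi⟩ (hpair ω)
      have hle : ∀ e ∈ active κ π N ω, ∀ σ : F → Bool, σ e = true →
          costTo fac z (I ∪ {i ∈ active κ π P ω | σ i = true}) ≤ α := fun e hmem σ hσ =>
        (he ω e (hsub ω hmem) σ hσ).trans (hc e (mem_active.mp hmem).1).le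
      have hN := div_le_div_of_nonneg_right (biasedExpect_le_three hq0 hq1 hik hil hkl (hD ω)
        (hle i hi) (hle k hk) (hle l hl)) hα.le
      rw [add_div, mul_div_assoc, sub_div, div_self hα.ne'] at hN
      rw [Finset.sum_sub_distrib, Finset.sum_const, nsmul_eq_mul, ← Finset.sum_div]
      have hlow' : ((active κ π N ω).card : ℝ) - 1 ≤
          (∑ i ∈ active κ π N ω, cost z (fac i)) / α := by
        rw [le_div_iff₀ hα]; linarith
      have m1 := mul_le_mul_of_nonneg_left hlow' (mul_nonneg (by linarith : 0 ≤ M) hq0)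
      have m2 := mul_le_mul_of_nonneg_left hRD (pow_nonneg hr 3)
      linarith
    · refine (min_le_left _ _).trans ?_
      obtain ⟨i, k, hik, hset⟩ := Finset.card_eq_two.mp h2.symm
      have hi : i ∈ active κ π N ω := by simp [hset]
      have hk : k ∈ active κ π N ω := by simp [hset]
      have hlow := card_sub_one_mul_le_sum fac z ⟨i, hi⟩ (hpair ω)
      rw [← h2, hset, Finset.sum_pair hik] at hlow
      have hs : 1 ≤ cost z (fac i) / α + cost z (fac k) / α := by
        rw [← add_div, le_div_iff₀ hα]; push_cast at hlow; linarith
      have n1 := div_le_div_of_nonneg_right (biasedExpect_le_two hq0 hq1 hik (hD ω)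
        (he ω i (hsub ω hi)) (he ω k (hsub ω hk))) hα.le
      have n2 := div_le_div_of_nonneg_right (biasedExpect_le_two hq0 hq1 hik.symm (hD ω)
        (he ω k (hsub ω hk)) (he ω i (hsub ω hi))) hα.le
      rw [add_div, mul_div_assoc, mul_div_assoc, add_div, mul_div_assoc, mul_div_assoc] at n1 n2
      rw [hset, Finset.sum_pair hik]
      have m2 := mul_le_mul_of_nonneg_left hRD (pow_nonneg hr 2)
      have hcoef : 0 ≤ M * q - q * (2 - q) / 2 := by nlinarith
      have m3 := mul_le_mul_of_nonneg_left hs hcoef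
      linarith

end Slack

/-! ### Geometric estimates around the witness -/

section Geometry

variable {d : ℕ}

/-- The points `a` and `b` are near `s` and far from each other, so that a convex combination of the
costs of a point `z` near `s` is smaller than the triangle inequality gives. -/
theorem mix_cost_le {z s a b : EuclideanSpace ℝ (Fin d)} {α ts ta tb δ θ : ℝ}
    (hz : cost z s ≤ α) (hts : ts ≤ α) (hδ : 2 ≤ δ)
    (ha : cost s a ≤ 2 * min ts ta) (hb : cost s b ≤ δ * min ts tb)
    (hab : 2 * min ta tb ≤ cost a b) (hθ0 : 0 ≤ θ) (hθ1 : θ ≤ 1) :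
    θ * cost z a + (1 - θ) * cost z b ≤ α * mixBound δ θ := by
  have hα : 0 ≤ α := (cost_nonneg _ _).trans hz
  obtain ⟨v, hv⟩ : ∃ v, v = z - s := ⟨_, rfl⟩
  obtain ⟨a', ha'⟩ : ∃ a', a' = a - s := ⟨_, rfl⟩
  obtain ⟨b', hb'⟩ : ∃ b', b' = b - s := ⟨_, rfl⟩
  obtain ⟨A, hA⟩ : ∃ A, A = cost s a := ⟨_, rfl⟩
  obtain ⟨B, hB⟩ : ∃ B, B = cost s b := ⟨_, rfl⟩
  obtain ⟨C, hC⟩ : ∃ C, C = cost a b := ⟨_, rfl⟩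
  have eA : ‖a'‖ ^ 2 = A := by rw [hA, ha']; unfold cost; rw [dist_comm, dist_eq_norm]
  have eB : ‖b'‖ ^ 2 = B := by rw [hB, hb']; unfold cost; rw [dist_comm, dist_eq_norm]
  have eV : ‖v‖ ^ 2 = cost z s := by rw [hv]; unfold cost; rw [dist_eq_norm]
  have eC : C = A + B - 2 * inner ℝ a' b' := by
    rw [hC]; unfold cost
    rw [dist_eq_norm, ← sub_sub_sub_cancel_right a b s, ← ha', ← hb', norm_sub_sq_real, eA, eB]
    ring
  have eza : cost z a = ‖v‖ ^ 2 + A - 2 * inner ℝ v a' := by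
    unfold cost
    rw [dist_eq_norm, ← sub_sub_sub_cancel_right z a s, ← ha', ← hv, norm_sub_sq_real, eA]
    ring
  have ezb : cost z b = ‖v‖ ^ 2 + B - 2 * inner ℝ v b' := by
    unfold cost
    rw [dist_eq_norm, ← sub_sub_sub_cancel_right z b s, ← hb', ← hv, norm_sub_sq_real, eB]
    ring
  rw [← hA] at ha
  rw [← hB] at hb
  rw [← hC] at hab
  have hA0 : 0 ≤ A := by rw [hA]; exact cost_nonneg _ _
  have hB0 : 0 ≤ B := by rw [hB]; exact cost_nonneg _ _
  have hA1 : A ≤ 2 * α := ha.trans (by linarith [min_le_left ts ta])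
  have hA2 : A ≤ 2 * ta := ha.trans (by linarith [min_le_right ts ta])
  have hB1 : B ≤ δ * α :=
    hb.trans (mul_le_mul_of_nonneg_left ((min_le_left _ _).trans hts) (by linarith))
  have hB2 : B ≤ δ * tb := hb.trans (mul_le_mul_of_nonneg_left (min_le_right _ _) (by linarith))
  have hθ' := sub_nonneg.mpr hθ1
  -- The position of `z` relative to `a` and `b` enters the mixture only through the inner product
  -- with `X`, and `X` is short because `a` and `b` are far apart.
  obtain ⟨X, hX⟩ : ∃ X, X = θ • a' + (1 - θ) • b' := ⟨_, rfl⟩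
  have eX : ‖X‖ ^ 2 = θ * A + (1 - θ) * B - θ * (1 - θ) * C := by
    rw [hX, norm_add_sq_real, norm_smul, norm_smul, mul_pow, mul_pow, eA, eB, inner_smul_left,
      inner_smul_right, eC, Real.norm_eq_abs, Real.norm_eq_abs, sq_abs, sq_abs]
    simp only [conj_trivial]
    ring
  have hXle : ‖X‖ ^ 2 ≤ α * (2 * θ ^ 2 + (1 - θ) * δ) := by
    rw [eX]
    -- If `ta` is the smaller, then `C ≥ 2ta ≥ A`. Otherwise write `B = δβ` with `β ≤ tb`, so that
    -- `C ≥ 2β`; the remaining coefficient `δ - 2θ` of `β` is nonnegative because `δ ≥ 2`.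
    rcases le_total ta tb with h | h
    · rw [min_eq_left h] at hab
      have hCA : A ≤ C := hA2.trans hab
      have m1 := mul_le_mul_of_nonneg_left hCA (mul_nonneg hθ0 hθ')
      have m2 := mul_le_mul_of_nonneg_left hA1 (mul_nonneg hθ0 hθ0)
      have m3 := mul_le_mul_of_nonneg_left hB1 hθ'
      linarith
    · rw [min_eq_right h] at hab
      have hδpos : 0 < δ := by linarith
      obtain ⟨β, hβ⟩ : ∃ β, B = δ * β := ⟨B / δ, by field_simp⟩
      have hβ1 : β ≤ α := by
        rw [hβ] at hB1; exact le_of_mul_le_mul_left hB1 hδpos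
      have hβ2 : β ≤ tb := by
        rw [hβ] at hB2; exact le_of_mul_le_mul_left hB2 hδpos
      have m1 := mul_le_mul_of_nonneg_left (show 2 * β ≤ C by linarith) (mul_nonneg hθ0 hθ')
      have m2 := mul_le_mul_of_nonneg_left hA1 hθ0
      have m3 := mul_le_mul_of_nonneg_left hβ1
        (mul_nonneg hθ' (show 0 ≤ δ - 2 * θ by linarith))
      rw [hβ]
      linarith
  have hQ0 : 0 ≤ 2 * θ ^ 2 + (1 - θ) * δ :=
    add_nonneg (by positivity) (mul_nonneg hθ' (by linarith))
  have hin : -inner ℝ v X ≤ α * √(2 * θ ^ 2 + (1 - θ) * δ) := by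
    have h1 : -inner ℝ v X ≤ ‖v‖ * ‖X‖ := by
      have := neg_le_abs (inner ℝ v X)
      exact this.trans (abs_real_inner_le_norm v X)
    have h2 : ‖v‖ ≤ √α := Real.le_sqrt_of_sq_le (by rw [eV]; exact hz)
    have h3 : ‖X‖ ≤ √α * √(2 * θ ^ 2 + (1 - θ) * δ) := by
      rw [← Real.sqrt_mul hα]; exact Real.le_sqrt_of_sq_le hXle
    have h4 := mul_le_mul h2 h3 (norm_nonneg _) (Real.sqrt_nonneg _)
    have h5 : √α * (√α * √(2 * θ ^ 2 + (1 - θ) * δ)) = α * √(2 * θ ^ 2 + (1 - θ) * δ) := by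
      rw [← mul_assoc, Real.mul_self_sqrt hα]
    linarith
  have hlin : inner ℝ v X = θ * inner ℝ v a' + (1 - θ) * inner ℝ v b' := by
    rw [hX, inner_add_right, inner_smul_right, inner_smul_right]
  have m1 := mul_le_mul_of_nonneg_left hA1 hθ0
  have m2 := mul_le_mul_of_nonneg_left hB1 hθ'
  rw [eza, ezb]
  unfold mixBound
  rw [hlin] at hin
  rw [eV]
  linarith

end Geometry

/-! ### The guarantee for a single client -/

section Client

variable {d : ℕ} {F : Type*} {fac : F → EuclideanSpace ℝ (Fin d)} {t : F → ℝ}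
  {δ₁ δ₃ p : ℝ} {V I₁ I₂ I₃ : Finset F} {z : EuclideanSpace ℝ (Fin d)} {α : ℝ}

theorem cost_self (x : EuclideanSpace ℝ (Fin d)) : cost x x = 0 := by simp [cost]

/-- Maximality in metric form; a point of `I` is near itself at cost `0`. -/
theorem IsMaxIndepIn.exists_near [DecidableEq F] {δ : ℝ} {W I : Finset F}
    (h : IsMaxIndepIn (conflictGraph fac t δ) W I) {v : F} (hv : v ∈ W) (ht : 0 ≤ t v)
    (hδ : 0 ≤ δ) : ∃ i ∈ I, cost (fac v) (fac i) ≤ δ * min (t v) (t i) := by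
  by_cases hvI : v ∈ I
  · refine ⟨v, hvI, ?_⟩
    rw [cost_self, min_self]
    exact mul_nonneg hδ ht
  · obtain ⟨i, hi, hadj⟩ := h.exists_adj hv hvI
    exact ⟨i, hi, hadj.2⟩

theorem sqrt_costTo_le {I : Finset F} {i : F} (hi : i ∈ I) (s : EuclideanSpace ℝ (Fin d)) {δ τ : ℝ}
    (hδ : 0 ≤ δ) (h : cost s (fac i) ≤ δ * τ) :
    √(costTo fac z I) ≤ √(cost z s) + √δ * √τ := by
  refine (Real.sqrt_le_sqrt (costTo_le fac z hi)).trans ((sqrt_cost_triangle z s (fac i)).trans ?_)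
  rw [← Real.sqrt_mul hδ]
  exact add_le_add_right (Real.sqrt_le_sqrt h) _

theorem costTo_le_mul {I : Finset F} {i : F} (hi : i ∈ I) {s : EuclideanSpace ℝ (Fin d)} {δ τ : ℝ}
    (hδ : 0 ≤ δ) (hα : 0 ≤ α) (hs : cost z s ≤ α) (hτ : τ ≤ α) (h : cost s (fac i) ≤ δ * τ) :
    costTo fac z I ≤ (1 + √δ) ^ 2 * α := by
  have h1 := sqrt_costTo_le (z := z) hi s hδ h
  have h2 := Real.sqrt_le_sqrt hs
  have h3 := mul_le_mul_of_nonneg_left (Real.sqrt_le_sqrt hτ) (Real.sqrt_nonneg δ)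
  have h4 : √(costTo fac z I) ≤ (1 + √δ) * √α := by linarith
  rw [← Real.sq_sqrt (costTo_nonneg fac z I), ← Real.sq_sqrt hα, ← mul_pow]
  exact pow_le_pow_left₀ (Real.sqrt_nonneg _) h4 2

/-- Two points of the neighbourhood of `z` that are far from each other are not close to `z`. -/
theorem div_bounds_of_far {a b : EuclideanSpace ℝ (Fin d)} (hα : 0 < α)
    (hab : 2 * α ≤ cost a b) (hb : cost z b ≤ α) :
    3 - 2 * √2 ≤ cost z a / α ∧ 1 ≤ cost z a / α + cost z b / α := by
  have hroot : √2 ≤ √(cost z a / α) + √(cost z b / α) := by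
    rw [Real.sqrt_div' _ hα.le, Real.sqrt_div' _ hα.le, ← add_div,
      le_div_iff₀ (Real.sqrt_pos.mpr hα), ← Real.sqrt_mul (by norm_num)]
    refine (Real.sqrt_le_sqrt hab).trans ((sqrt_cost_triangle a z b).trans ?_)
    rw [cost_comm a z]
  have hxa := Real.sq_sqrt (div_nonneg (cost_nonneg z a) hα.le)
  have hxb := Real.sq_sqrt (div_nonneg (cost_nonneg z b) hα.le)
  have hle1 : √(cost z b / α) ≤ 1 := by
    rw [Real.sqrt_le_one, div_le_one hα]; exact hb
  obtain ⟨a1, a2⟩ := sqrt_two_bounds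
  have hs2 : √2 ^ 2 = 2 := Real.sq_sqrt (by norm_num)
  rw [← hxa, ← hxb]
  generalize √(cost z a / α) = x at *
  generalize √(cost z b / α) = y at *
  constructor
  · have := pow_le_pow_left₀ (by linarith) (show √2 - 1 ≤ x by linarith) 2
    linarith
  · have := pow_le_pow_left₀ (by linarith) hroot 2
    linarith [sq_nonneg (x - y)]

variable [DecidableEq F]

set_option maxHeartbeats 1000000 in
/-- The averaged slack of a client without a neighbour in `I₁` whose witness is `s`. -/
theorem sum_slack_nonneg [Fintype F] (hδ₁ : δ₁ = (4 + 8 * √2) / 7)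
    (hδ₃ : δ₃ = 6 - 4 * √2 ∨ δ₃ = 0.265) (hp0 : 0.096 ≤ p) (hp1 : p ≤ 0.402)
    (ht : ∀ i ∈ V, 0 ≤ t i) (h : IsNestedQuasiIndep fac t δ₁ 2 δ₃ V I₁ I₂ I₃) (hα : 0 < α)
    {N : Finset F} (hN : N ⊆ I₂ ∪ I₃) (hαt : ∀ i ∈ N, α ≤ t i) (hc : ∀ i ∈ N, cost z (fac i) < α)
    {s : F} (hs : s ∈ V) (hts : t s ≤ α) (hzs : cost z (fac s) ≤ α)
    {M : ℝ} (hM₁ : 3 + 2 * √2 ≤ M) (hM₂ : mixBound δ₁ p ≤ M) (hM₃ : singleBound δ₁ δ₃ p ≤ M)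
    (hM₄ : oppositeBound δ₁ δ₃ p ≤ M) {f : (F → Bool) → ℝ}
    (hf : SlackBounds (coinOf (conflictGraph fac t 2) I₂) (fun i => decide (i ∈ I₂)) (I₂ ∪ I₃) N
      (fun i => cost z (fac i) / α) M (costTo fac z I₁ / α) (2 * p)
      (pairSlack M ((1 + √δ₁) ^ 2) (2 * p)) f) :
    0 ≤ ∑ ω, f ω := by
  obtain ⟨a1, a2⟩ := sqrt_two_bounds
  have hs2 : √2 ^ 2 = 2 := Real.sq_sqrt (by norm_num)
  obtain ⟨b1, b2, b3, b4⟩ := sqrt_delta_one_bounds hδ₁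
  obtain ⟨c1, c2, c3, c4⟩ := sqrt_delta_three_bounds hδ₃
  have hsα : 0 < √α := Real.sqrt_pos.mpr hα
  have hR : (1 + √δ₁) ^ 2 ≤ 6.146 := by nlinarith
  have hM1 : 1 ≤ M := by linarith
  obtain ⟨k₁, hk₁, hk₁s⟩ := h.first.exists_near hs (ht s hs) (by linarith)
  have hDR : costTo fac z I₁ / α ≤ (1 + √δ₁) ^ 2 := by
    rw [div_le_iff₀ hα]
    exact costTo_le_mul hk₁ (by linarith) hα.le hzs ((min_le_left _ _).trans hts) hk₁s
  obtain ⟨-, hΦ₁, hΦ₂, hΦ₃⟩ := pairSlack_bounds hM₁ hR (by linarith : 0.192 ≤ 2 * p)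
    (by linarith) hDR
  -- A point of `I₁` this near the witness gives `D ≤ (1 + √2)² = 3 + 2√2 ≤ M`. Otherwise the
  -- witness belongs to `levelTwo`.
  by_cases hclose : ∃ i ∈ I₁, cost (fac s) (fac i) ≤ 2 * min (t s) (t i)
  · obtain ⟨i, hi, his⟩ := hclose
    refine hf.sum_nonneg_of_le ?_
    rw [div_le_iff₀ hα]
    refine (costTo_le_mul hi (by norm_num) hα.le hzs ((min_le_left _ _).trans hts) his).trans ?_
    refine mul_le_mul_of_nonneg_right ?_ hα.le
    nlinarith
  push Not at hclose
  have hsI : s ∉ I₁ := fun hsI => by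
    have := hclose s hsI
    rw [cost_self, min_self] at this
    linarith [ht s hs]
  have hs2mem : s ∈ levelTwo fac t 2 V I₁ := by
    simp only [levelTwo, Finset.mem_filter, Finset.mem_sdiff]
    exact ⟨⟨hs, hsI⟩, fun i hi hadj => absurd hadj.2 (not_le.mpr (hclose i hi))⟩
  obtain ⟨k₂, hk₂, hk₂s⟩ := h.second.exists_near hs2mem (ht s hs) (by norm_num)
  -- A candidate near the witness is far from `k₁`, since no candidate is `H(2)`-adjacent to `I₁`.
  have hmix : ∀ k ∈ I₂ ∪ I₃, cost (fac s) (fac k) ≤ 2 * min (t s) (t k) →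
      ∀ θ : ℝ, 2 * p / 2 ≤ θ → θ ≤ 1 →
        θ * (cost z (fac k) / α) + (1 - θ) * (costTo fac z I₁ / α) ≤ M := by
    intro k hk hks θ hθ0 hθ1
    have hkk : k ≠ k₁ := fun e => Finset.disjoint_left.mp h.disjoint_one hk₁ (e ▸ hk)
    have hnadj : ¬ (conflictGraph fac t 2).Adj k k₁ := by
      rcases Finset.mem_union.mp hk with hk | hk
      · exact (h.mem_two hk).2.2 k₁ hk₁
      · exact (h.mem_three hk).2.2.2.1 k₁ hk₁
    have hm := mix_cost_le (θ := θ) hzs hts (by linarith) hks hk₁s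
      (lt_cost_of_not_adj hkk hnadj).le (by linarith) hθ1
    have hle := mul_le_mul_of_nonneg_left (costTo_le fac z hk₁) (sub_nonneg.mpr hθ1)
    have hmax := mixBound_le_max (δ := δ₁) (p := p) (by linarith) (by linarith) (by linarith)
      (by linarith) hθ1
    have hmaxM : mixBound δ₁ θ ≤ M := hmax.trans (max_le hM₁ hM₂)
    have hαM := mul_le_mul_of_nonneg_left hmaxM hα.le
    rw [← mul_div_assoc, ← mul_div_assoc, ← add_div, div_le_iff₀ hα]
    linarith
  have hI3 : ∀ {i}, i ∈ I₃ → i ∉ I₂ := fun hi => (h.mem_three hi).2.2.1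
  by_cases hC : ∃ e ∈ N, e ∈ I₂ ∧ ∃ g ∈ N, g ∈ I₃ ∧ coinOf (conflictGraph fac t 2) I₂ g = e
  · obtain ⟨e, he, he2, g, hg, hg3, hge⟩ := hC
    have hκe := h.coinOf_two he2
    refine hf.sum_nonneg_of_opposite hΦ₁ he hg (by rw [hκe, hge]) (by simpa using he2)
      (by simpa using hI3 hg3) ?_ ?_
    · intro i hi hκ hπ
      have hi2 : i ∈ I₂ := by simpa using hπ
      rwa [h.coinOf_two hi2, hκe] at hκ
    · intro g hg hκ hπ
      have hg2 : g ∉ I₂ := by simpa using hπ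
      have hg3 := (Finset.mem_union.mp (hN hg)).resolve_left hg2
      rw [hκe] at hκ
      have hge : g ≠ e := fun e' => hg2 (e' ▸ he2)
      have hfar := (lt_cost_of_not_adj hge ((h.mem_three hg3).2.2.2.2.2 e he2)).le
      have hDv : ∀ v ∈ V, √(costTo fac z I₁ / α) ≤
          √(cost z (fac v) / α) + √δ₁ * √(t v / α) := by
        intro v hv
        obtain ⟨i, hi, hiv⟩ := h.first.exists_near hv (ht v hv) (by linarith)
        have h1 := sqrt_costTo_le (z := z) hi (fac v) (by linarith : 0 ≤ δ₁)
          (hiv.trans (mul_le_mul_of_nonneg_left (min_le_left _ _) (by linarith)))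
        rw [Real.sqrt_div' _ hα.le, Real.sqrt_div' _ hα.le, Real.sqrt_div' _ hα.le,
          ← mul_div_assoc, ← add_div]
        exact div_le_div_of_nonneg_right h1 hsα.le
      have hsum : ∀ τ, τ = min (t g) (t e) → √δ₃ * √(τ / α) ≤
          √(cost z (fac e) / α) + √(cost z (fac g) / α) := by
        intro τ hτ
        rw [Real.sqrt_div' _ hα.le, Real.sqrt_div' _ hα.le, Real.sqrt_div' _ hα.le,
          ← mul_div_assoc, ← add_div]
        refine div_le_div_of_nonneg_right ?_ hsα.le
        rw [← Real.sqrt_mul (by linarith), hτ]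
        refine (Real.sqrt_le_sqrt hfar).trans ((sqrt_cost_triangle _ z _).trans ?_)
        rw [cost_comm (fac g) z, add_comm]
      have hD0 : 0 ≤ costTo fac z I₁ / α := div_nonneg (costTo_nonneg _ _ _) hα.le
      have hxe : √(cost z (fac e) / α) ^ 2 = cost z (fac e) / α :=
        Real.sq_sqrt (div_nonneg (cost_nonneg _ _) hα.le)
      have hxg : √(cost z (fac g) / α) ^ 2 = cost z (fac g) / α :=
        Real.sq_sqrt (div_nonneg (cost_nonneg _ _) hα.le)
      -- The point with the smaller `t`-value plays the role of `a`: its own `t` bounds its distance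
      -- to `I₁`, and the same `t` bounds the distance between `e` and `g` from below.
      rcases le_total (t g) (t e) with hle | hle
      · have hfin := oppositeBound_mul_ge (p := p) (by linarith) (by linarith) (by linarith)
          (by linarith) hD0 hDR ((hsum (t g) (min_eq_left hle).symm).trans_eq (add_comm _ _))
          (hDv g (h.mem_three hg3).1) hM₄ hM1
        rw [hxe, hxg] at hfin
        linarith
      · have hfin := oppositeBound_mul_ge (p := p) (by linarith) (by linarith) (by linarith)
          (by linarith) hD0 hDR (hsum (t e) (min_eq_right hle).symm)
          (hDv e (h.mem_two he2).1) hM₄ hM1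
        rw [hxe, hxg] at hfin
        linarith
  push Not at hC
  by_cases hb : ∃ e ∈ N, e ∈ I₂
  · obtain ⟨e, he, he2⟩ := hb
    have hκe := h.coinOf_two he2
    have hsing : ∀ i ∈ N, coinOf (conflictGraph fac t 2) I₂ i =
        coinOf (conflictGraph fac t 2) I₂ e → i = e := by
      intro i hi hκ
      rw [hκe] at hκ
      rcases Finset.mem_union.mp (hN hi) with hi2 | hi3
      · rwa [h.coinOf_two hi2] at hκ
      · exact absurd hκ (hC e he he2 i hi hi3)
    by_cases he' : ∃ e' ∈ N, coinOf (conflictGraph fac t 2) I₂ e' ≠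
        coinOf (conflictGraph fac t 2) I₂ e
    · obtain ⟨e', he', hκ⟩ := he'
      have hne : e ≠ e' := fun hh => hκ (hh ▸ rfl)
      have hnadj : ¬ (conflictGraph fac t 2).Adj e e' :=
        h.not_adj ht (by linarith) (Finset.mem_union_right _ (hN he))
          (Finset.mem_union_right _ (hN he')) (fun _ _ => by rwa [hκe] at hκ)
          (fun _ he3 => absurd he2 (hI3 he3))
      have hfar : 2 * α ≤ cost (fac e) (fac e') := by
        have h1 := lt_cost_of_not_adj hne hnadj
        have h2 := le_min (hαt e he) (hαt e' he')
        linarith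
      obtain ⟨hx, hxx⟩ := div_bounds_of_far (z := z) hα hfar (hc e' he').le
      refine hf.sum_nonneg_of_two_coins hΦ₁ hΦ₂ hΦ₃ he he' hκ (by simpa using he2) hsing ?_ hx hxx
      · intro i hi hκi
        by_cases hi2 : i ∈ I₂ <;> by_cases he'2 : e' ∈ I₂
        · simp [hi2, he'2]
        · rw [h.coinOf_two hi2] at hκi
          exact absurd hκi.symm (hC i hi hi2 e' he'
            ((Finset.mem_union.mp (hN he')).resolve_left he'2))
        · rw [h.coinOf_two he'2] at hκi
          exact absurd hκi (hC e' he' he'2 i hi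
            ((Finset.mem_union.mp (hN hi)).resolve_left hi2))
        · simp [hi2, he'2]
    · push Not at he'
      have hNe : N = {e} :=
        Finset.eq_singleton_iff_unique_mem.mpr ⟨he, fun i hi => hsing i hi (he' i hi)⟩
      subst hNe
      refine hf.sum_nonneg_of_singleton (by simpa using he2) ?_
      by_cases hk : ∃ k ∈ I₂ ∪ I₃, k ≠ e ∧ cost (fac s) (fac k) ≤ 2 * min (t s) (t k)
      · obtain ⟨k, hk, hke, hks⟩ := hk
        refine Or.inr ⟨k, hk, hke, fun hκ => ?_, hmix k hk hks⟩
        rw [hκe] at hκ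
        have : k ∉ I₂ := fun hk2 => hke (by rwa [h.coinOf_two hk2] at hκ)
        simpa using this
      · push Not at hk
        have hk2e : ∀ k ∈ I₂ ∪ I₃, cost (fac s) (fac k) ≤ 2 * min (t s) (t k) → k = e := by
          intro k hkP hks
          by_contra hke
          exact absurd hks (not_le.mpr (hk k hkP hke))
        -- Here `e` is the only candidate near the witness `s`. If `s` were farther from `e`, it
        -- would qualify for `levelThree`, and maximality of `I₃` would put a point of `I₃` near
        -- `s`, hence equal to `e ∈ I₂`.
        have hnear : cost (fac s) (fac e) ≤ δ₃ * t s := by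
          by_cases hse : s = e
          · rw [hse, cost_self]
            exact mul_nonneg (by linarith) (ht e (h.mem_two he2).1)
          have hsI2 : s ∉ I₂ := fun hsI2 => hse (hk2e s (Finset.mem_union_left _ hsI2) (by
            rw [cost_self, min_self]; linarith [ht s hs]))
          by_contra hcon
          have hk₂e := hk2e k₂ (Finset.mem_union_left _ hk₂) hk₂s
          rw [hk₂e] at hk₂s
          have hs3 : s ∈ levelThree fac t 2 δ₃ V I₁ I₂ := by
            simp only [levelThree, Finset.mem_filter, Finset.mem_sdiff]
            refine ⟨⟨hs2mem, hsI2⟩, ⟨e, ⟨he2, hse, hk₂s⟩, fun k hk => ?_⟩, ?_, ?_⟩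
            · exact hk2e k (Finset.mem_union_left _ hk.1) hk.2.2
            · exact fun i hi hadj => absurd hadj.2 (not_le.mpr (hclose i hi))
            · intro k hk hadj
              have hm : 0 ≤ min (t s) (t k) := le_min (ht s hs) (ht k (h.mem_two hk).1)
              have hke := hk2e k (Finset.mem_union_left _ hk) (hadj.2.trans
                (mul_le_mul_of_nonneg_right (by linarith) hm))
              rw [hke] at hadj
              exact hcon (hadj.2.trans
                (mul_le_mul_of_nonneg_left (min_le_left _ _) (by linarith)))
          obtain ⟨k₃, hk₃, hk₃s⟩ := h.third.exists_near hs3 (ht s hs) (by norm_num)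
          have := hk2e k₃ (Finset.mem_union_right _ hk₃) hk₃s
          exact hI3 hk₃ (this ▸ he2)
        left
        have hroot : √(costTo fac z I₁ / α) ≤ √(cost z (fac e) / α) + √δ₃ + √δ₁ := by
          have h1 := sqrt_costTo_le (z := z) hk₁ (fac s) (by linarith : 0 ≤ δ₁)
            (hk₁s.trans (mul_le_mul_of_nonneg_left ((min_le_left _ _).trans hts) (by linarith)))
          have h2 := sqrt_cost_triangle z (fac e) (fac s)
          have h3 : √(cost (fac e) (fac s)) ≤ √δ₃ * √α := by
            rw [← Real.sqrt_mul (by linarith), cost_comm]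
            exact Real.sqrt_le_sqrt (hnear.trans (mul_le_mul_of_nonneg_left hts (by linarith)))
          rw [Real.sqrt_div' _ hα.le, Real.sqrt_div' _ hα.le, div_add' _ _ _ hsα.ne',
            div_add' _ _ _ hsα.ne']
          exact div_le_div_of_nonneg_right (by linarith) hsα.le
        have hD0 : 0 ≤ costTo fac z I₁ / α := div_nonneg (costTo_nonneg _ _ _) hα.le
        have hDle : costTo fac z I₁ / α ≤ (√(cost z (fac e) / α) + √δ₃ + √δ₁) ^ 2 := by
          rw [← Real.sq_sqrt hD0]
          exact pow_le_pow_left₀ (Real.sqrt_nonneg _) hroot 2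
        have hfin := singleBound_mul_ge (p := p) b1.le b2.le c1.le (by linarith) (by linarith) hp1
          (Real.sqrt_nonneg (cost z (fac e) / α)) hDR hDle
        have hxe := Real.sq_sqrt (div_nonneg (cost_nonneg z (fac e)) hα.le)
        rw [hxe] at hfin
        have hpos : 0 ≤ 1 - p + p * (cost z (fac e) / α) :=
          add_nonneg (by linarith) (mul_nonneg (by linarith)
            (div_nonneg (cost_nonneg _ _) hα.le))
        have := mul_le_mul_of_nonneg_right hM₃ hpos
        linarith
  · push Not at hb
    -- Now `N` has no point of `I₂`, so the second-level point `k₂` near the witness lies outside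
    -- `N` and has polarity `true`.
    exact hf.sum_nonneg_of_all_false (fun i hi => by simpa using hb i hi)
      (Finset.mem_union_left _ hk₂) (fun hkN => hb k₂ hkN hk₂) (by simpa using hk₂)
      (hmix k₂ (Finset.mem_union_left _ hk₂) hk₂s)

end Client

/-! ### Assembling the guarantee for one client -/

section Guarantee

theorem hasClientGuarantee {δ₁ δ₃ p ρ : ℝ} (hδ₁ : δ₁ = (4 + 8 * √2) / 7)
    (hδ₃ : δ₃ = 6 - 4 * √2 ∨ δ₃ = 0.265) (hp0 : 0 ≤ p) (hp1 : p < 1 / 2) (hρ : 3 + 2 * √2 ≤ ρ)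
    (hρp : 1 ≤ ρ * (1 - 2 * p))
    (hcase : (1 + √δ₁) ^ 2 ≤ ρ * (1 - 2 * p) ∨ (0.096 ≤ p ∧ p ≤ 0.402 ∧ mixBound δ₁ p ≤ ρ ∧
      singleBound δ₁ δ₃ p ≤ ρ ∧ oppositeBound δ₁ δ₃ p ≤ ρ)) :
    HasClientGuarantee.{u, v} δ₁ 2 δ₃ p ρ := by
  intro d F D _ _ fac cl V α t N w hW I₁ I₂ I₃ h j
  obtain ⟨a1, a2⟩ := sqrt_two_bounds
  obtain ⟨b1, b2, b3, b4⟩ := sqrt_delta_one_bounds hδ₁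
  have ht := hW.t_nonneg
  have hρpos : 0 < ρ := by linarith
  have hq0 : 0 ≤ 2 * p := by linarith
  have hq1 : 2 * p ≤ 1 := by linarith
  obtain ⟨κ, hκ⟩ : ∃ κ, κ = coinOf (conflictGraph fac t 2) I₂ := ⟨_, rfl⟩
  obtain ⟨π, hπ⟩ : ∃ π : F → Bool, π = fun i => decide (i ∈ I₂) := ⟨_, rfl⟩
  have hdis : ∀ ω, Disjoint I₁ (active κ π (I₂ ∪ I₃) ω) := fun ω =>
    Finset.disjoint_of_subset_right (Finset.filter_subset _ _) h.disjoint_one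
  rw [expect_eq_sum_biasedExpect, expect_eq_sum_biasedExpect, mul_left_comm]
  refine mul_le_mul_of_nonneg_left ?_ (Finset.prod_nonneg fun _ _ => by norm_num)
  simp only [h.centers_eq, ← hκ, ← hπ, biasedExpect_sum_inter _ _ _ _ _ (hdis _)]
  have hcl := hW.cost_lt_alpha j
  have hαt := hW.alpha_le_t j
  have hpair : ∀ ω, ∀ i ∈ N j ∩ (I₁ ∪ active κ π (I₂ ∪ I₃) ω),
      ∀ k ∈ N j ∩ (I₁ ∪ active κ π (I₂ ∪ I₃) ω), i ≠ k → 2 * α j ≤ cost (fac i) (fac k) := by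
    intro ω i hi k hk hik
    rw [Finset.mem_inter] at hi hk
    rw [hκ, hπ] at hi hk
    have h1 := lt_cost_of_not_adj hik
      (h.not_adj_of_active ht (by linarith) ω hi.2 hk.2)
    have h2 := le_min (hαt i hi.1) (hαt k hk.1)
    linarith
  have hpair₁ : ∀ i ∈ N j ∩ I₁, ∀ k ∈ N j ∩ I₁, i ≠ k → δ₁ * α j ≤ cost (fac i) (fac k) := by
    intro i hi k hk hik
    rw [Finset.mem_inter] at hi hk
    have h1 := lt_cost_of_not_adj hik (h.first.not_adj hi.2 hk.2)
    have h2 := le_min (hαt i hi.1) (hαt k hk.1)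
    exact (mul_le_mul_of_nonneg_left h2 (by linarith)).trans h1.le
  obtain ⟨k₁, hk₁, hk₁s⟩ := h.first.exists_near (hW.witness_mem j) (ht _ (hW.witness_mem j))
    (by linarith)
  have hα0 := hW.alpha_nonneg j
  have hDR : costTo fac (cl j) I₁ ≤ (1 + √δ₁) ^ 2 * α j :=
    costTo_le_mul hk₁ (by linarith) hα0 (hW.cost_witness_le j)
      ((min_le_left _ _).trans (hW.t_witness_le j)) hk₁s
  rcases (N j ∩ I₁).eq_empty_or_nonempty with hempty | hne
  · simp only [hempty, Finset.sum_empty, sub_zero]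
    have hnum : ∀ ω, biasedExpect (2 * p) (fun σ =>
        costTo fac (cl j) (I₁ ∪ {i ∈ active κ π (I₂ ∪ I₃) ω | σ i = true})) ≤
        (1 + √δ₁) ^ 2 * α j := fun ω => biasedExpect_le_of_forall_le hq0 hq1 fun σ =>
      (costTo_anti fac (cl j) ⟨k₁, hk₁⟩ Finset.subset_union_left).trans hDR
    -- The case `α j = 0` is separated because the slack is normalized by `α j`; there the
    -- neighbourhood is empty and the upper bound on the cost is `0`.
    rcases hα0.eq_or_lt with hα | hα
    · have hN : N j = ∅ := by
        refine Finset.eq_empty_of_forall_notMem fun i hi => ?_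
        have h1 := hcl i hi
        have h2 := cost_nonneg (cl j) (fac i)
        linarith
      rw [Finset.mul_sum]
      refine Finset.sum_le_sum fun ω _ => (hnum ω).trans ?_
      simp [hN, ← hα]
    -- The crude case needs no averaging: the active neighbours receive at most `α j` in total, so
    -- the net payment is at least `(1 - 2p) α j` for every outcome of the fair coins.
    · rcases hcase with hcase | ⟨hp2, hp3, hM₂, hM₃, hM₄⟩
      · rw [Finset.mul_sum]
        refine Finset.sum_le_sum fun ω _ => (hnum ω).trans ?_
        have hden : (1 - 2 * p) * α j ≤
            α j - 2 * p * ∑ i ∈ N j ∩ active κ π (I₂ ∪ I₃) ω, (α j - cost (cl j) (fac i)) := by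
          have : ∑ i ∈ N j ∩ active κ π (I₂ ∪ I₃) ω, (α j - cost (cl j) (fac i)) ≤ α j := by
            rcases (N j ∩ active κ π (I₂ ∪ I₃) ω).eq_empty_or_nonempty with h0 | h0
            · rw [h0]; simpa using hα0
            · have := card_sub_one_mul_le_sum fac (cl j) h0 (α := α j) (fun i hi k hk =>
                hpair ω i (Finset.inter_subset_inter_left Finset.subset_union_right hi) k
                  (Finset.inter_subset_inter_left Finset.subset_union_right hk))
              rw [Finset.sum_sub_distrib, Finset.sum_const, nsmul_eq_mul]
              linarith
          have := mul_le_mul_of_nonneg_left this hq0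
          linarith
        have m1 := mul_le_mul_of_nonneg_right hcase hα0
        have m2 := mul_le_mul_of_nonneg_left hden hρpos.le
        linarith
      · have hact : ∀ ω, N j ∩ active κ π (I₂ ∪ I₃) ω = active κ π (N j ∩ (I₂ ∪ I₃)) ω :=
          fun ω => Finset.inter_filter _ _ _
        have hR : (1 + √δ₁) ^ 2 ≤ 6.146 := by nlinarith
        have hsb := slackBounds fac (cl j) hα (P := I₂ ∪ I₃) (N := N j ∩ (I₂ ∪ I₃)) (κ := κ)
          (π := π) ⟨k₁, hk₁⟩ Finset.inter_subset_right
          (fun i hi => hcl i (Finset.mem_inter.mp hi).1)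
          (fun ω i hi k hk => hpair ω i
            (Finset.inter_subset_inter_left Finset.subset_union_right (by rwa [hact])) k
            (Finset.inter_subset_inter_left Finset.subset_union_right (by rwa [hact])))
          (M := ρ) (by linarith) hq0 hq1 hDR
          (pairSlack_bounds hρ hR (by linarith) (by linarith) le_rfl).1
        have hsum := hsb
        rw [hκ, hπ] at hsum
        have hfin := sum_slack_nonneg hδ₁ hδ₃ hp2 hp3 ht h hα Finset.inter_subset_right
          (fun i hi => hαt i (Finset.mem_inter.mp hi).1)
          (fun i hi => hcl i (Finset.mem_inter.mp hi).1) (hW.witness_mem j) (hW.t_witness_le j)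
          (hW.cost_witness_le j) hρ hM₂ hM₃ hM₄ hsum
        rw [← hκ, ← hπ] at hfin
        have hmul := mul_nonneg hα0 hfin
        rw [Finset.mul_sum] at hmul ⊢
        rw [← sub_nonneg, ← Finset.sum_sub_distrib]
        refine hmul.trans_eq (Finset.sum_congr rfl fun ω _ => ?_)
        rw [hact]
        have e1 : ∑ i ∈ active κ π (N j ∩ (I₂ ∪ I₃)) ω, (α j - cost (cl j) (fac i)) =
            α j * ∑ i ∈ active κ π (N j ∩ (I₂ ∪ I₃)) ω, (1 - cost (cl j) (fac i) / α j) := by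
          rw [Finset.mul_sum]
          refine Finset.sum_congr rfl fun i _ => ?_
          field_simp
        rw [e1]
        field_simp
  · rw [Finset.mul_sum]
    exact Finset.sum_le_sum fun ω _ => biasedExpect_costTo_le_of_inter_nonempty fac (cl j) (hdis ω)
      hne hα0 hδ₁ hq0 hq1 hρ hρp (hpair ω) hpair₁

end Guarantee

/-! ### The primal-dual procedure -/

section PrimalDual

variable {d : ℕ} {F D : Type*} (fac : F → EuclideanSpace ℝ (Fin d))
  (cl : D → EuclideanSpace ℝ (Fin d))

open scoped Classical in
/-- The values of the clients at time `θ` when the clients `j ∈ U` freeze at `α j` and the others do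
not freeze. -/
def valueAt (U : Finset D) (α : D → ℝ) (θ : ℝ) (j : D) : ℝ :=
  if j ∈ U then min (α j) θ else θ

theorem valueAt_le (U : Finset D) (α : D → ℝ) (θ : ℝ) (j : D) : valueAt U α θ j ≤ θ := by
  unfold valueAt
  split_ifs
  · exact min_le_right _ _
  · exact le_rfl

variable [Fintype D]

theorem continuous_payment_valueAt (U : Finset D) (α : D → ℝ) (i : F) :
    Continuous fun θ => payment fac cl (valueAt U α θ) i := by
  unfold payment
  refine continuous_finsetSum _ fun j _ => ?_
  by_cases hj : j ∈ U
  · simp only [valueAt, hj, if_true]; fun_prop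
  · simp only [valueAt, hj, if_false]; fun_prop

/-- If all clients that can pay for the facility `i` are frozen whenever `i` is tight, then `i` is
never overpaid. -/
theorem payment_valueAt_le {U : Finset D} {α : D → ℝ} {i : F} {lam τ θ₁ : ℝ} (hτ : τ ≤ θ₁)
    (h0 : payment fac cl (valueAt U α τ) i ≤ lam)
    (hfreeze : ∀ θ, τ ≤ θ → θ < θ₁ → payment fac cl (valueAt U α θ) i = lam →
      ∀ j, cost (cl j) (fac i) ≤ θ → j ∈ U ∧ α j ≤ θ) :
    payment fac cl (valueAt U α θ₁) i ≤ lam := by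
  by_contra hcon
  push Not at hcon
  have hcont := continuous_payment_valueAt fac cl U α i
  have hcpt : IsCompact {θ | θ ∈ Set.Icc τ θ₁ ∧ payment fac cl (valueAt U α θ) i ≤ lam} :=
    isCompact_Icc.inter_right (isClosed_le hcont continuous_const)
  -- `θ₀` is the last time at which `i` is not overpaid. By continuity `i` is tight there; the
  -- clients that reach it are frozen and the others contribute nothing for a little longer, so the
  -- payment stays constant beyond `θ₀`, a contradiction.
  obtain ⟨θ₀, ⟨⟨hθ₀, hle⟩, hmax⟩⟩ := hcpt.exists_isGreatest ⟨τ, ⟨le_rfl, hτ⟩, h0⟩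
  have hlt : θ₀ < θ₁ := lt_of_le_of_ne hθ₀.2 fun e => by rw [e] at hle; linarith
  have heq : payment fac cl (valueAt U α θ₀) i = lam := by
    obtain ⟨θ, hθ, hθe⟩ := intermediate_value_Icc hlt.le hcont.continuousOn ⟨hle, hcon.le⟩
    have : θ ≤ θ₀ := hmax ⟨⟨hθ₀.1.trans hθ.1, hθ.2⟩, hθe.le⟩
    rwa [le_antisymm this hθ.1] at hθe
  have hev : ∀ᶠ θ in nhdsWithin θ₀ (Set.Ioi θ₀), θ ≤ θ₁ ∧
      ∀ j, θ₀ < cost (cl j) (fac i) → θ ≤ cost (cl j) (fac i) := by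
    refine Filter.Eventually.and ?_ (Filter.eventually_all.mpr fun j => ?_)
    · exact Filter.Eventually.filter_mono nhdsWithin_le_nhds (eventually_le_nhds hlt)
    · by_cases hj : θ₀ < cost (cl j) (fac i)
      · exact (Filter.Eventually.filter_mono nhdsWithin_le_nhds (eventually_le_nhds hj)).mono
          fun θ hθ _ => hθ
      · exact Filter.Eventually.of_forall fun θ h => absurd h hj
  obtain ⟨θ₂, ⟨h2, h2c⟩, h2g⟩ := (hev.and self_mem_nhdsWithin).exists
  have h2g' : θ₀ < θ₂ := h2g
  have hsame : payment fac cl (valueAt U α θ₂) i = payment fac cl (valueAt U α θ₀) i := by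
    unfold payment
    refine Finset.sum_congr rfl fun j _ => ?_
    rcases le_or_gt (cost (cl j) (fac i)) θ₀ with hj | hj
    · obtain ⟨hU, hα⟩ := hfreeze θ₀ hθ₀.1 hlt heq j hj
      simp only [valueAt, hU, if_true]
      rw [min_eq_left hα, min_eq_left (hα.trans h2g'.le)]
    · have h3 := valueAt_le U α θ₂ j
      have h4 := valueAt_le U α θ₀ j
      have h5 := h2c j hj
      rw [max_eq_right (by linarith), max_eq_right (by linarith)]
  have : θ₂ ≤ θ₀ := hmax ⟨⟨hθ₀.1.trans h2g'.le, h2⟩, (hsame.trans heq).le⟩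
  linarith

/-- The times at which there is a tight facility that `j` can reach. -/
def freezeTimes (lam : ℝ) (U : Finset D) (α : D → ℝ) (j : D) : Set ℝ :=
  {θ | ∃ i, cost (cl j) (fac i) ≤ θ ∧ payment fac cl (valueAt U α θ) i = lam}

/-- A state of the primal-dual procedure: the clients in `U` are frozen, and `τ` is the current
time. -/
structure IsState (lam : ℝ) (U : Finset D) (α : D → ℝ) (τ : ℝ) : Prop where
  le_time : ∀ j ∈ U, α j ≤ τ
  isLeast : ∀ j ∈ U, IsLeast (freezeTimes fac cl lam U α j) (α j)
  time_le : ∀ j ∉ U, ∀ θ ∈ freezeTimes fac cl lam U α j, τ ≤ θ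
  payment_le : ∀ i, payment fac cl (valueAt U α τ) i ≤ lam

-- One event of the procedure: `τ'` is the first time at which some unfrozen client reaches a tight
-- facility, and one such client is frozen there. Simultaneous events are handled by further steps
-- with the same time.
open scoped Classical in
theorem IsState.exists_insert [Finite F] [Nonempty F] {lam : ℝ} (hlam : 0 ≤ lam) {U : Finset D}
    {α : D → ℝ} {τ : ℝ} (h : IsState fac cl lam U α τ) (hU : ∃ j, j ∉ U) :
    ∃ j ∉ U, ∃ α' τ', IsState fac cl lam (insert j U) α' τ' := by
  obtain ⟨W, hW⟩ : ∃ W : Set ℝ, W = {θ | ∃ j i, j ∉ U ∧ cost (cl j) (fac i) ≤ θ ∧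
    payment fac cl (valueAt U α θ) i = lam} := ⟨_, rfl⟩
  have hWmem : ∀ {j θ}, j ∉ U → θ ∈ freezeTimes fac cl lam U α j → θ ∈ W := by
    rintro j θ hj ⟨i, hi⟩
    rw [hW]; exact ⟨j, i, hj, hi⟩
  have hWne : W.Nonempty := by
    have : Nonempty {j // j ∉ U} := hU.elim fun j hj => ⟨⟨j, hj⟩⟩
    -- For a cheapest pair of an unfrozen client `j` and a facility `i`, all clients that reach `i`
    -- before time `c(j, i)` are frozen, so `i` is not overpaid at `max τ (c(j, i))`. After `lam`
    -- further units of time `j` alone pays at least `lam`, so `i` is tight at some time in between.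
    obtain ⟨⟨⟨j, hj⟩, i⟩, hmin⟩ :=
      Finite.exists_min (fun x : {j // j ∉ U} × F => cost (cl x.1) (fac x.2))
    have hm : payment fac cl (valueAt U α (max τ (cost (cl j) (fac i)))) i ≤ lam := by
      refine payment_valueAt_le fac cl (le_max_left _ _) (h.payment_le i) ?_
      intro θ hτθ hθ _ j' hj'
      have hθ' : θ < cost (cl j) (fac i) := (lt_max_iff.mp hθ).resolve_left (not_lt.mpr hτθ)
      have hj'U : j' ∈ U := by
        by_contra hcon
        have : cost (cl j) (fac i) ≤ cost (cl j') (fac i) := hmin ⟨⟨j', hcon⟩, i⟩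
        linarith
      exact ⟨hj'U, (h.le_time j' hj'U).trans hτθ⟩
    have hbig : lam ≤
        payment fac cl (valueAt U α (max τ (cost (cl j) (fac i)) + lam)) i := by
      unfold payment
      refine le_trans ?_ (Finset.single_le_sum (f := fun j => max (valueAt U α
        (max τ (cost (cl _) (fac i)) + lam) j - cost (cl j) (fac i)) 0)
        (fun _ _ => le_max_right _ _) (Finset.mem_univ j))
      refine le_trans ?_ (le_max_left _ _)
      simp only [valueAt, hj, if_false]
      linarith [le_max_right τ (cost (cl j) (fac i))]
    obtain ⟨θ, hθ, hθe⟩ := intermediate_value_Icc (by linarith)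
      (continuous_payment_valueAt fac cl U α i).continuousOn ⟨hm, hbig⟩
    exact ⟨θ, by rw [hW]; exact ⟨j, i, hj, (le_max_right _ _).trans hθ.1, hθe⟩⟩
  have hWbdd : τ ∈ lowerBounds W := by
    intro θ hθ
    rw [hW] at hθ
    obtain ⟨j, i, hj, hi⟩ := hθ
    exact h.time_le j hj θ ⟨i, hi⟩
  have hWcl : IsClosed W := by
    rw [hW]
    simp only [Set.ofPred_exists]
    refine isClosed_iUnion_of_finite fun j => isClosed_iUnion_of_finite fun i => ?_
    by_cases hj : j ∈ U
    · simp [hj]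
    · simp only [hj, not_false_eq_true, true_and]
      exact (isClosed_le continuous_const continuous_id).inter
        (isClosed_eq (continuous_payment_valueAt fac cl U α i) continuous_const)
  obtain ⟨τ', hτ'⟩ : ∃ τ', IsLeast W τ' := ⟨_, hWcl.isLeast_csInf hWne ⟨τ, hWbdd⟩⟩
  have hττ' : τ ≤ τ' := hWbdd hτ'.1
  obtain ⟨j₀, i₀, hj₀, hi₀⟩ : ∃ j i, j ∉ U ∧ cost (cl j) (fac i) ≤ τ' ∧
      payment fac cl (valueAt U α τ') i = lam := by
    have := hτ'.1
    rwa [hW] at this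
  -- Freezing `j₀` at `τ'` leaves all values up to `τ'` unchanged, so earlier freezing times stay
  -- valid.
  have hval : ∀ θ, θ ≤ τ' → valueAt (insert j₀ U) (Function.update α j₀ τ') θ = valueAt U α θ := by
    intro θ hθ
    funext j
    by_cases hj : j = j₀
    · subst hj
      simp [valueAt, hj₀, hθ]
    · simp [valueAt, hj]
  have hfr : ∀ j θ, θ ≤ τ' → (θ ∈ freezeTimes fac cl lam (insert j₀ U)
      (Function.update α j₀ τ') j ↔ θ ∈ freezeTimes fac cl lam U α j) := by
    intro j θ hθ
    simp only [freezeTimes, Set.mem_ofPred_eq, hval θ hθ]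
  have hne : ∀ {j}, j ∈ U → j ≠ j₀ := fun hj e => hj₀ (e ▸ hj)
  refine ⟨j₀, hj₀, Function.update α j₀ τ', τ', ?_, ?_, ?_, ?_⟩
  · intro j hj
    rcases Finset.mem_insert.mp hj with rfl | hj
    · simp
    · rw [Function.update_of_ne (hne hj)]
      exact (h.le_time j hj).trans hττ'
  · intro j hj
    rcases Finset.mem_insert.mp hj with rfl | hj
    · rw [Function.update_self]
      refine ⟨(hfr j τ' le_rfl).mpr ⟨i₀, hi₀⟩, fun θ hθ => ?_⟩
      by_contra hcon
      push Not at hcon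
      exact absurd (hτ'.2 (hWmem hj₀ ((hfr j θ hcon.le).mp hθ))) (not_le.mpr hcon)
    · rw [Function.update_of_ne (hne hj)]
      have hle := (h.le_time j hj).trans hττ'
      refine ⟨(hfr j _ hle).mpr (h.isLeast j hj).1, fun θ hθ => ?_⟩
      rcases le_total θ τ' with hθ' | hθ'
      · exact (h.isLeast j hj).2 ((hfr j θ hθ').mp hθ)
      · exact hle.trans hθ'
  · intro j hj θ hθ
    rw [Finset.mem_insert, not_or] at hj
    by_contra hcon
    push Not at hcon
    exact absurd (hτ'.2 (hWmem hj.2 ((hfr j θ hcon.le).mp hθ))) (not_le.mpr hcon)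
  · intro i
    rw [hval τ' le_rfl]
    refine payment_valueAt_le fac cl hττ' (h.payment_le i) ?_
    intro θ hθ hθ' hpay j hj
    have hjU : j ∈ U := by
      by_contra hcon
      exact absurd (hτ'.2 (hWmem hcon ⟨i, hj, hpay⟩)) (not_le.mpr hθ')
    exact ⟨hjU, (h.le_time j hjU).trans hθ⟩

theorem payment_valueAt_zero_le {lam : ℝ} (hlam : 0 ≤ lam) (U : Finset D) (α : D → ℝ) (i : F) :
    payment fac cl (valueAt U α 0) i ≤ lam := by
  refine le_trans (le_of_eq ?_) hlam
  unfold payment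
  refine Finset.sum_eq_zero fun j _ => max_eq_right ?_
  have h1 := valueAt_le U α 0 j
  have h2 := cost_nonneg (cl j) (fac i)
  linarith

open scoped Classical in
theorem exists_isPrimalDualOutput [Finite F] [Nonempty F] {lam : ℝ} (hlam : 0 ≤ lam) :
    ∃ α, IsPrimalDualOutput fac cl lam α := by
  have hstate : ∀ n ≤ Fintype.card D, ∃ U : Finset D, U.card = n ∧
      ∃ α τ, IsState fac cl lam U α τ := by
    intro n
    induction n with
    | zero =>
      intro _
      refine ⟨∅, rfl, fun _ => 0, 0, by simp, by simp, ?_, ?_⟩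
      · rintro j _ θ ⟨i, hi, _⟩
        exact (cost_nonneg _ _).trans hi
      · exact payment_valueAt_zero_le fac cl hlam _ _
    | succ n ih =>
      intro hn
      obtain ⟨U, hU, α, τ, hs⟩ := ih (by omega)
      have : ∃ j, j ∉ U := by
        by_contra hcon
        push Not at hcon
        have : U = Finset.univ := Finset.eq_univ_iff_forall.mpr hcon
        rw [this, Finset.card_univ] at hU
        omega
      obtain ⟨j, hj, α', τ', hs'⟩ := hs.exists_insert fac cl hlam this
      exact ⟨insert j U, by rw [Finset.card_insert_of_notMem hj, hU], α', τ', hs'⟩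
  obtain ⟨U, hU, α, τ, hs⟩ := hstate _ le_rfl
  have hUu : U = Finset.univ := Finset.eq_univ_of_card U hU
  subst hUu
  refine ⟨α, fun j => ?_⟩
  have h := hs.isLeast j (Finset.mem_univ j)
  have e : ∀ θ, valueAt Finset.univ α θ = fun j' => min (α j') θ := by
    intro θ; funext j'; simp [valueAt]
  simpa only [freezeTimes, e] using h

variable {fac cl}

namespace IsPrimalDualOutput

variable {lam : ℝ} {α : D → ℝ}

theorem nonneg (h : IsPrimalDualOutput fac cl lam α) (j : D) : 0 ≤ α j := by
  obtain ⟨i, hi, _⟩ := (h j).1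
  exact (cost_nonneg _ _).trans hi

/-- Dual feasibility: a client that reaches a tight facility has already stopped growing. The sum of
all `α j` serves as a time after which nothing changes. -/
theorem payment_le (h : IsPrimalDualOutput fac cl lam α) (hlam : 0 ≤ lam) (i : F) :
    payment fac cl α i ≤ lam := by
  have e : ∀ θ, valueAt Finset.univ α θ = fun j' => min (α j') θ := by
    intro θ; funext j'; simp [valueAt]
  have hT : 0 ≤ ∑ j, α j := Finset.sum_nonneg fun j _ => h.nonneg j
  have hle := payment_valueAt_le fac cl (U := Finset.univ) (α := α) (i := i) hT
    (payment_valueAt_zero_le fac cl hlam _ _ _) (by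
      intro θ _ _ hpay j hj
      rw [e] at hpay
      exact ⟨Finset.mem_univ j, (h j).2 ⟨i, hj, hpay⟩⟩)
  rw [e] at hle
  have : (fun j' => min (α j') (∑ j, α j)) = α := by
    funext j
    exact min_eq_left (Finset.single_le_sum (fun j _ => h.nonneg j) (Finset.mem_univ j))
  rwa [this] at hle

/-- Weak duality. A client is needed to conclude `y i ≥ 0`, which is implied only through `0 ≤ x i j
≤ y i`. -/
theorem sum_le_lpValue [Fintype F] [Nonempty D] (h : IsPrimalDualOutput fac cl lam α) (hlam : 0 ≤ lam)
    {x : F → D → ℝ} {y : F → ℝ} (hxy : LPFeasible x y) : ∑ j, α j ≤ lpValue fac cl lam x y := by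
  have h1 : ∑ j, α j ≤ ∑ j, ∑ i, x i j * α j := by
    refine Finset.sum_le_sum fun j _ => ?_
    rw [← Finset.sum_mul]
    exact le_mul_of_one_le_left (h.nonneg j) (hxy.covered j)
  refine h1.trans ?_
  rw [Finset.sum_comm]
  unfold lpValue
  rw [Finset.mul_sum, ← Finset.sum_add_distrib]
  refine Finset.sum_le_sum fun i _ => ?_
  have j₀ := Classical.arbitrary D
  have hy : 0 ≤ y i := (hxy.nonneg i j₀).trans (hxy.le_open i j₀)
  have h2 : ∑ j, x i j * (α j - cost (cl j) (fac i)) ≤ y i * payment fac cl α i := by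
    unfold payment
    rw [Finset.mul_sum]
    refine Finset.sum_le_sum fun j _ => ?_
    exact (mul_le_mul_of_nonneg_left (le_max_left _ _) (hxy.nonneg i j)).trans
      (mul_le_mul_of_nonneg_right (hxy.le_open i j) (le_max_right _ _))
  have h3 := mul_le_mul_of_nonneg_left (h.payment_le hlam i) hy
  simp only [mul_sub, Finset.sum_sub_distrib] at h2
  linarith

end IsPrimalDualOutput

end PrimalDual

/-! ### The approximation guarantee -/

section Approximation

variable {d : ℕ} {F D : Type*} [Fintype F] [Fintype D] {fac : F → EuclideanSpace ℝ (Fin d)}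
  {cl : D → EuclideanSpace ℝ (Fin d)} {lam : ℝ} {α : D → ℝ}

open scoped Classical in
/-- The tight facilities that `j` pays for. -/
def tightNbhd (fac : F → EuclideanSpace ℝ (Fin d)) (cl : D → EuclideanSpace ℝ (Fin d)) (lam : ℝ)
    (α : D → ℝ) (j : D) : Finset F :=
  {i ∈ tightSet fac cl lam α | cost (cl j) (fac i) < α j}

theorem mem_tightSet {i : F} : i ∈ tightSet fac cl lam α ↔ payment fac cl α i = lam := by
  simp [tightSet]

/-- The witness of `j` is the facility that froze it. It is tight at time `α j` and at the end, so
no client paying for it can grow past `α j`: its contribution would have increased. This gives `t (w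
j) ≤ α j`. -/
theorem IsPrimalDualOutput.exists_witnessAssumptions (h : IsPrimalDualOutput fac cl lam α)
    (hlam : 0 ≤ lam) : ∃ w, WitnessAssumptions fac cl (tightSet fac cl lam α) α (tValue fac cl α)
      (tightNbhd fac cl lam α) w := by
  choose w hw using fun j => (h j).1
  have hmono : ∀ (i : F) (θ : ℝ) (j : D), max (min (α j) θ - cost (cl j) (fac i)) 0 ≤
      max (α j - cost (cl j) (fac i)) 0 := fun i θ j =>
    max_le_max_right _ (sub_le_sub_right (min_le_left _ _) _)
  have htight : ∀ j, payment fac cl α (w j) = lam := by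
    intro j
    refine le_antisymm (h.payment_le hlam _) ?_
    rw [← (hw j).2]
    exact Finset.sum_le_sum fun j' _ => hmono (w j) (α j) j'
  refine ⟨w, h.nonneg, ?_, ?_, ?_, ?_, fun j => (hw j).1, ?_, ?_⟩
  · exact fun i _ => Real.iSup_nonneg fun j => h.nonneg j
  · exact fun j => Finset.filter_subset _ _
  · exact fun j => mem_tightSet.mpr (htight j)
  · intro j
    refine Real.iSup_le (fun j' => ?_) (h.nonneg j)
    by_contra hcon
    push Not at hcon
    have hlt : payment fac cl (fun j' => min (α j') (α j)) (w j) < payment fac cl α (w j) := by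
      refine Finset.sum_lt_sum (fun k _ => hmono (w j) (α j) k) ⟨j', Finset.mem_univ _, ?_⟩
      have h1 := j'.2
      beta_reduce
      rw [min_eq_right hcon.le, max_eq_left (sub_nonneg.mpr h1.le)]
      exact max_lt (by linarith) (by linarith)
    rw [(hw j).2, htight j] at hlt
    exact lt_irrefl _ hlt
  · intro j i hi
    have hi' : cost (cl j) (fac i) < α j := (Finset.mem_filter.mp hi).2
    exact le_ciSup (f := fun j : {j : D // cost (cl j) (fac i) < α j} => α j)
      (Set.finite_range _).bddAbove ⟨j, hi'⟩
  · exact fun j i hi => (Finset.mem_filter.mp hi).2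

/-- After exchanging the sums, each open facility is tight and collects exactly `lam`. -/
theorem sum_sub_tightNbhd [DecidableEq F] {S : Finset F} (hS : S ⊆ tightSet fac cl lam α) :
    ∑ j, (α j - ∑ i ∈ tightNbhd fac cl lam α j ∩ S, (α j - cost (cl j) (fac i))) =
      ∑ j, α j - lam * S.card := by
  classical
  rw [Finset.sum_sub_distrib]
  congr 1
  have h1 : ∀ j, ∑ i ∈ tightNbhd fac cl lam α j ∩ S, (α j - cost (cl j) (fac i)) =
      ∑ i ∈ S, max (α j - cost (cl j) (fac i)) 0 := by
    intro j
    have : tightNbhd fac cl lam α j ∩ S = {i ∈ S | cost (cl j) (fac i) < α j} := by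
      ext i
      simp only [tightNbhd, Finset.mem_inter, Finset.mem_filter]
      exact ⟨fun h => ⟨h.2, h.1.2⟩, fun h => ⟨⟨hS h.1, h.2⟩, h.1⟩⟩
    rw [this, Finset.sum_filter]
    refine Finset.sum_congr rfl fun i _ => ?_
    split_ifs with h
    · rw [max_eq_left (sub_nonneg.mpr h.le)]
    · rw [max_eq_right (by linarith)]
  simp only [h1]
  rw [Finset.sum_comm]
  have h2 : ∀ i ∈ S, ∑ j, max (α j - cost (cl j) (fac i)) 0 = lam :=
    fun i hi => mem_tightSet.mp (hS hi)
  rw [Finset.sum_congr rfl h2, Finset.sum_const, nsmul_eq_mul, mul_comm]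

theorem isLMPApprox_of_hasClientGuarantee {δ₁ δ₂ δ₃ p ρ : ℝ} (hρ : 0 ≤ ρ)
    (h : HasClientGuarantee.{u, v} δ₁ δ₂ δ₃ p ρ) : IsLMPApprox.{u, v} δ₁ δ₂ δ₃ p ρ := by
  intro d F D _ _ _ _ _ fac cl lam hlam
  constructor
  · obtain ⟨α, hα⟩ := exists_isPrimalDualOutput fac cl hlam
    obtain ⟨I₁, h₁⟩ := exists_isMaxIndepIn (conflictGraph fac (tValue fac cl α) δ₁)
      (tightSet fac cl lam α)
    obtain ⟨I₂, h₂⟩ := exists_isMaxIndepIn (conflictGraph fac (tValue fac cl α) δ₂)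
      (levelTwo fac (tValue fac cl α) δ₂ (tightSet fac cl lam α) I₁)
    obtain ⟨I₃, h₃⟩ := exists_isMaxIndepIn (conflictGraph fac (tValue fac cl α) δ₂)
      (levelThree fac (tValue fac cl α) δ₂ δ₃ (tightSet fac cl lam α) I₁ I₂)
    exact ⟨α, I₁, I₂, I₃, hα, h₁, h₂, h₃⟩
  · intro α I₁ I₂ I₃ hrun
    obtain ⟨w, hW⟩ := hrun.dual.exists_witnessAssumptions hlam
    have hj := h d F D fac cl _ α _ _ w hW I₁ I₂ I₃ hrun.nested
    have hsum := Finset.sum_le_sum fun j (_ : j ∈ Finset.univ) => hj j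
    rw [← expect_sum, ← Finset.mul_sum, ← expect_sum] at hsum
    refine hsum.trans (mul_le_mul_of_nonneg_left ?_ hρ)
    simp only [sum_sub_tightNbhd (hrun.nested.centers_subset _)]
    have hconst : expect p (fun _ : Coins F => ∑ j, α j) = ∑ j, α j := by
      rw [expect_eq_sum_biasedExpect]
      simp only [biasedExpect_const, Finset.sum_const, Finset.prod_const, nsmul_eq_mul,
        Finset.card_univ, Fintype.card_fun, Fintype.card_bool]
      rw [← mul_assoc]
      push_cast
      rw [← mul_pow]
      norm_num
    have hexp : expect p (fun ω => ∑ j, α j -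
        lam * ((centers fac (tValue fac cl α) δ₂ I₁ I₂ I₃ ω).card : ℝ)) =
        expect p (fun _ : Coins F => ∑ j, α j) - lam * expect p (fun ω =>
          ((centers fac (tValue fac cl α) δ₂ I₁ I₂ I₃ ω).card : ℝ)) := by
      unfold expect
      rw [Finset.mul_sum, ← Finset.sum_sub_distrib]
      exact Finset.sum_congr rfl fun ω _ => by ring
    rw [hexp, hconst]
    refine sub_le_sub_right ?_ _
    refine le_csInf ?_ ?_
    · refine ⟨_, fun _ _ => 1, fun _ => 1, ⟨fun j => ?_, fun _ _ => zero_le_one,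
        fun _ _ => le_rfl⟩, rfl⟩
      simp only [Finset.sum_const, Finset.card_univ, nsmul_eq_mul, mul_one]
      exact_mod_cast Fintype.card_pos
    · rintro v ⟨x, y, hxy, rfl⟩
      exact hrun.dual.sum_le_lpValue hlam hxy

end Approximation

end KMeansLMP

end

/-! ### The choice of `ρ` and the final theorem -/

theorem mainTheorem3 (δ₁ δ₂ δ₃ : ℝ) (hδ₁ : δ₁ = (4 + 8 * √2) / 7) (hδ₂ : δ₂ = 2)
    (hδ₃ : δ₃ = 6 - 4 * √2 ∨ δ₃ = 0.265) :
    ∃ ρ : ℝ → ℝ,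
      (∀ p : ℝ, 0 ≤ p → p < 1 / 2 →
        KMeansLMP.HasClientGuarantee.{u, v} δ₁ δ₂ δ₃ p (ρ p)) ∧
      (∀ p : ℝ, 0 ≤ p → p < 1 / 2 →
        KMeansLMP.IsLMPApprox.{u, v} δ₁ δ₂ δ₃ p (ρ p)) ∧
      (∀ p : ℝ, 0.096 ≤ p → p ≤ 0.402 →
        ρ p ≤ max (max (3 + 2 * √2)
            (1 + 2 * p + (1 - p) * δ₁ + 2 * √(2 * p ^ 2 + (1 - p) * δ₁)))
          (max
            (((1 - p) * (1 + √δ₁) ^ 2 + p * (1 - √δ₃) ^ 2) / (1 - p + p * (1 - √δ₃) ^ 2))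
            (((1 - 2 * p) * (1 + √δ₁) ^ 2 * (δ₁ + (√δ₁ + √δ₃) ^ 2) + p * (1 + √δ₁) ^ 2 * δ₃) /
              ((1 - 2 * p) * (δ₁ + (√δ₁ + √δ₃) ^ 2) + p * (1 + √δ₁) ^ 2 * δ₃)))) ∧
      ρ 0.402 ≤ 3 + 2 * √2 ∧
      KMeansLMP.IsLMPApprox.{u, v} δ₁ δ₂ δ₃ 0.402 (3 + 2 * √2) := by
  subst hδ₂
  obtain ⟨a1, a2⟩ := KMeansLMP.sqrt_two_bounds
  obtain ⟨b1, b2, b3, b4⟩ := KMeansLMP.sqrt_delta_one_bounds hδ₁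
  have hs2 : √2 ^ 2 = 2 := Real.sq_sqrt (by norm_num)
  obtain ⟨B, hB⟩ : ∃ B : ℝ → ℝ, B = fun p => max (max (3 + 2 * √2) (KMeansLMP.mixBound δ₁ p))
    (max (KMeansLMP.singleBound δ₁ δ₃ p) (KMeansLMP.oppositeBound δ₁ δ₃ p)) := ⟨_, rfl⟩
  have hB1 : ∀ p, 3 + 2 * √2 ≤ B p := fun p => by
    rw [hB]; exact (le_max_left _ _).trans (le_max_left _ _)
  -- On `[0.096, 0.402]` the maximum of the four numbers; elsewhere the crude ratio of the largest
  -- cost to the smallest net payment.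
  obtain ⟨ρ, hρ⟩ : ∃ ρ : ℝ → ℝ, ρ = fun p =>
    if 0.096 ≤ p ∧ p ≤ 0.402 then B p else (1 + √δ₁) ^ 2 / (1 - 2 * p) := ⟨_, rfl⟩
  have hρin : ∀ p, 0.096 ≤ p → p ≤ 0.402 → ρ p = B p := fun p h1 h2 => by
    rw [hρ]; exact if_pos ⟨h1, h2⟩
  -- This holds since `δ₁ ≥ 2`; it makes the crude value at least `3 + 2√2`, as the case of a
  -- neighbour in `I₁` requires.
  have hR : 3 + 2 * √2 ≤ (1 + √δ₁) ^ 2 := by nlinarith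
  have hge : ∀ p, 0 ≤ p → p < 1 / 2 → 3 + 2 * √2 ≤ ρ p := by
    intro p h0 h1
    by_cases hp : 0.096 ≤ p ∧ p ≤ 0.402
    · rw [hρin p hp.1 hp.2]; exact hB1 p
    · rw [hρ]
      simp only [if_neg hp]
      rw [le_div_iff₀ (by linarith)]
      nlinarith
  have hclient : ∀ p : ℝ, 0 ≤ p → p < 1 / 2 →
      KMeansLMP.HasClientGuarantee.{u, v} δ₁ 2 δ₃ p (ρ p) := by
    intro p h0 h1
    by_cases hp : 0.096 ≤ p ∧ p ≤ 0.402
    · rw [hρin p hp.1 hp.2]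
      refine KMeansLMP.hasClientGuarantee hδ₁ hδ₃ h0 h1 (hB1 p) ?_
        (Or.inr ⟨hp.1, hp.2, ?_, ?_, ?_⟩)
      · have := mul_le_mul (show 5.8 ≤ B p by linarith [hB1 p])
          (show 0.196 ≤ 1 - 2 * p by linarith [hp.2]) (by norm_num) (by linarith [hB1 p])
        linarith
      · rw [hB]; exact (le_max_right _ _).trans (le_max_left _ _)
      · rw [hB]; exact (le_max_left _ _).trans (le_max_right _ _)
      · rw [hB]; exact (le_max_right _ _).trans (le_max_right _ _)
    · have hpos : 0 < 1 - 2 * p := by linarith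
      have he : ρ p * (1 - 2 * p) = (1 + √δ₁) ^ 2 := by
        rw [hρ]
        simp only [if_neg hp]
        exact div_mul_cancel₀ _ hpos.ne'
      refine KMeansLMP.hasClientGuarantee hδ₁ hδ₃ h0 h1 (hge p h0 h1) ?_ (Or.inl he.ge)
      rw [he]
      linarith
  have happrox : ∀ p : ℝ, 0 ≤ p → p < 1 / 2 →
      KMeansLMP.IsLMPApprox.{u, v} δ₁ 2 δ₃ p (ρ p) := fun p h0 h1 =>
    KMeansLMP.isLMPApprox_of_hasClientGuarantee (by linarith [hge p h0 h1]) (hclient p h0 h1)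
  have hfinal : ρ 0.402 = 3 + 2 * √2 := by
    rw [hρin 0.402 (by norm_num) le_rfl]
    refine le_antisymm ?_ (hB1 _)
    rw [hB]
    exact max_le (max_le le_rfl (KMeansLMP.mixBound_le hδ₁))
      (max_le (KMeansLMP.singleBound_le hδ₁ hδ₃) (KMeansLMP.oppositeBound_le hδ₁ hδ₃))
  refine ⟨ρ, hclient, happrox, fun p h0 h1 => ?_, hfinal.le, ?_⟩
  · rw [hρin p h0 h1, hB]
    exact le_rfl
  · rw [← hfinal]
    exact happrox 0.402 (by norm_num) (by norm_num)
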